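/- Let $R$ be the root system $B_l$ ($l\ge 2$), $C_l$ ($l\ge 2$) or $D_l$ ($l\ge 3$) in $V=\mathbb R^l$ with the standard inner product and orthonormal basis $\varepsilon_1,\dots,\varepsilon_l$, with simple roots $\alpha_i=\varepsilon_i-\varepsilon_{i+1}$ ($i<l$) and $\alpha_l=\varepsilon_l$, $2\varepsilon_l$, $\varepsilon_{l-1}+\varepsilon_l$ respectively. Let $\alpha_j^\vee=2\alpha_j/(\alpha_j,\alpha_j)$, let $\omega_1,\dots,\omega_l$ be the fundamental weights, $(\omega_i,\alpha_j^\vee)=\delta_{ij}$, let $W$ be the Weyl group and $f=\det\big((\alpha_i,\alpha_j^\vee)\big)$. Fix any $k\in\{1,\dots,l\}$ and put $\gamma=2$ if $R=B_l$ and $k=l$, and $\gamma=1$ otherwise. The extended affine Weyl group $\widetilde W^{(k)}$ acts on $V\oplus\mathbb R$, and by the same formulas on its complexification; it is generated by the maps $$(\mathbf x,x_{l+1})\mapsto\Big(w(\mathbf x)+\sum_{j=1}^l m_j\alpha_j^\vee,\;x_{l+1}\Big)\quad(w\in W,\ m_j\in\mathbb Z),\qquad (\mathbf x,x_{l+1})\mapsto(\mathbf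 x+\gamma\,\omega_k,\;x_{l+1}-\gamma).$$ Write $\mathbf x=x_1\alpha_1^\vee+\dots+x_l\alpha_l^\vee$. Let $\mathcal A$ be the ring of all $\widetilde W^{(k)}$-invariant Fourier polynomials (finite sums, $a_m\in\mathbb C$) $$\sum_{m\in\mathbb Z^{l+1}}a_m\,e^{2\pi i\left(m_1x_1+\dots+m_lx_l+\frac1{\gamma f}m_{l+1}x_{l+1}\right)}$$ that stay bounded as $\tau\to+\infty$ along $\mathbf x=\mathbf x^0-i\omega_k\tau$, $x_{l+1}=x_{l+1}^0+i\tau$, for every $x^0=(\mathbf x^0,x^0_{l+1})$. Put $d_j=(\omega_j,\omega_k)$ and, for $j=1,\dots,l$, $$y_j(\mathbf x)=\frac1{n_j}\sum_{w\in W}e^{2\pi i(\omega_j,w(\mathbf x))},\qquad n_j=\#\{w\in W: e^{2\pi i(\omega_j,w(\mathbf x))}=e^{2\pi i(\omega_j,\mathbf x)}\text{ for all }\mathbf x\},$$ $$\tilde y_j=e^{2\pi i d_jx_{l+1}}\,y_j(\mathbf x)\quad(1\le j\le l),\qquad \tilde y_{l+1}=e^{\frac{2\pi i}{\gamma}x_{l+1}}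 .$$ Then $\mathcal A$ is the polynomial ring in $\tilde y_1,\dots,\tilde y_{l+1}$: these functions belong to $\mathcal A$, and there is an isomorphism of $\mathbb C$-algebras $\mathbb C[X_1,\dots,X_{l+1}]\to\mathcal A$ with $X_j\mapsto\tilde y_j$ for all $j$. Moreover the limits $y_j^0(\mathbf x^0)=\lim_{\tau\to+\infty}e^{-2\pi d_j\tau}\,y_j(\mathbf x^0-i\omega_k\tau)$ exist for all $\mathbf x^0$ and all $j=1,\dots,l$, and the functions $y_1^0,\dots,y_l^0$ are algebraically independent over $\mathbb C$. -/

import Mathlib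

open Filter Topology Asymptotics

noncomputable section

namespace ExtAffine

/-- The three series of classical root systems considered here. -/
inductive BCD : Type
  | B
  | C
  | D

/-- Smallest rank of each series: `B_l` and `C_l` for `l ≥ 2`, `D_l` for `l ≥ 3`. -/
def BCD.minRank : BCD → ℕ
  | .B => 2
  | .C => 2
  | .D => 3

/-- The complexification `V_ℂ = ℂ^l` of the Euclidean space `V = ℝ^l`, in the orthonormal
coordinates `ε_1, …, ε_l`.  The Euclidean inner product is extended to the bilinear form
`x ⬝ᵥ y = ∑ x_a y_a`. -/
abbrev VC (l : ℕ) : Type := Fin l → ℂ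

/-- The simple roots in the standard realization: `α_i = ε_i - ε_{i+1}` for `i < l`, and
`α_l = ε_l`, `2 ε_l`, `ε_{l-1} + ε_l` for `B_l`, `C_l`, `D_l` respectively.
(Indices in `Fin l` start from `0`.) -/
def simpleRoot (T : BCD) (l : ℕ) (i : Fin l) : VC l :=
  if h : (i : ℕ) + 1 < l then
    Pi.single i (1 : ℂ) - Pi.single (⟨(i : ℕ) + 1, h⟩ : Fin l) (1 : ℂ)
  else
    match T with
    | .B => Pi.single i (1 : ℂ)
    | .C => Pi.single i (2 : ℂ)
    | .D => Pi.single (⟨(i : ℕ) - 1, by omega⟩ : Fin l) (1 : ℂ) + Pi.single i (1 : ℂ)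

/-- The coroot `α_i^∨ = 2 α_i / (α_i, α_i)`. -/
def simpleCoroot (T : BCD) (l : ℕ) (i : Fin l) : VC l :=
  (2 / (simpleRoot T l i ⬝ᵥ simpleRoot T l i)) • simpleRoot T l i

/-- The fundamental weights; see `fundWeight_dot_simpleCoroot` for the relations
`(ω_i, α_j^∨) = δ_ij` that determine them. -/
def fundWeight (T : BCD) (l : ℕ) (i : Fin l) : VC l := fun a =>
  match T with
  | .B => if (i : ℕ) + 1 < l then (if a ≤ i then 1 else 0) else 1 / 2
  | .C => if a ≤ i then 1 else 0
  | .D =>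
      if (i : ℕ) + 2 < l then (if a ≤ i then 1 else 0)
      else if (i : ℕ) + 1 < l then (if (a : ℕ) + 1 < l then 1 / 2 else -1 / 2)
      else 1 / 2

lemma simpleRoot_dot_self_ne_zero (T : BCD) (l : ℕ) (i : Fin l) :
    simpleRoot T l i ⬝ᵥ simpleRoot T l i ≠ 0 := by
  unfold simpleRoot
  split_ifs with h
  · have h1 : (⟨(i : ℕ) + 1, h⟩ : Fin l) ≠ i := by
      intro e; have := congrArg Fin.val e; simp at this
    simp [h1, h1.symm]
  · cases T
    · simp
    · simp
    · by_cases e : (⟨(i : ℕ) - 1, by omega⟩ : Fin l) = i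
      · simp [e]
      · simp [e, Ne.symm e]

lemma simpleCoroot_dot_simpleRoot (T : BCD) (l : ℕ) (i : Fin l) :
    simpleCoroot T l i ⬝ᵥ simpleRoot T l i = 2 := by
  simp [simpleCoroot, smul_dotProduct, simpleRoot_dot_self_ne_zero]

lemma simpleCoroot_eq (T : BCD) (l : ℕ) (hl : T.minRank ≤ l) (i : Fin l) :
    simpleCoroot T l i =
      if h : (i : ℕ) + 1 < l then
        Pi.single i (1 : ℂ) - Pi.single (⟨(i : ℕ) + 1, h⟩ : Fin l) (1 : ℂ)
      else
        match T with
        | .B => Pi.single i (2 : ℂ)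
        | .C => Pi.single i (1 : ℂ)
        | .D => Pi.single (⟨(i : ℕ) - 1, by omega⟩ : Fin l) (1 : ℂ) + Pi.single i (1 : ℂ) := by
  unfold simpleCoroot simpleRoot
  split_ifs with h
  · have h1 : (⟨(i : ℕ) + 1, h⟩ : Fin l) ≠ i := by
      intro e; have := congrArg Fin.val e; simp at this
    simp [h1, h1.symm]
    norm_num
  · cases T
    · ext a; simp [Pi.single_apply]
    · ext a; simp [Pi.single_apply]
    · have h1 : (⟨(i : ℕ) - 1, by omega⟩ : Fin l) ≠ i := by
        intro e; have := congrArg Fin.val e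
        simp only [BCD.minRank] at hl; simp at this; omega
      simp [h1, h1.symm]
      norm_num

/-- The relations `(ω_i, α_j^∨) = δ_ij`. -/
theorem fundWeight_dot_simpleCoroot (T : BCD) (l : ℕ) (hl : T.minRank ≤ l) (i j : Fin l) :
    fundWeight T l i ⬝ᵥ simpleCoroot T l j = if i = j then 1 else 0 := by
  rw [simpleCoroot_eq T l hl]
  have hi := i.isLt
  have hj := j.isLt
  cases T <;> simp only [BCD.minRank] at hl <;> split_ifs with h1 h2 h2 <;>
    simp only [dotProduct_sub, dotProduct_add, dotProduct_single, fundWeight, Fin.le_def,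
      Fin.ext_iff] at h2 ⊢ <;> split_ifs <;> first | omega | norm_num

/-- The coordinates `x_1, …, x_l` on `V_ℂ` with respect to the basis of simple coroots,
`𝐱 = ∑ x_j α_j^∨`; see `sum_coord_smul_simpleCoroot`. -/
def coord (T : BCD) (l : ℕ) (j : Fin l) (x : VC l) : ℂ := fundWeight T l j ⬝ᵥ x

/-- `𝐱 = x_1 α_1^∨ + ⋯ + x_l α_l^∨`. -/
theorem sum_coord_smul_simpleCoroot (T : BCD) (l : ℕ) (hl : T.minRank ≤ l) (x : VC l) :
    ∑ j, coord T l j x • simpleCoroot T l j = x := by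
  have h : Matrix.of (fundWeight T l) * (Matrix.of (simpleCoroot T l)).transpose = 1 := by
    ext i j
    rw [Matrix.one_apply, ← fundWeight_dot_simpleCoroot T l hl i j]
    rfl
  have h' := mul_eq_one_comm.mp h
  have h2 : ((Matrix.of (simpleCoroot T l)).transpose).mulVec
      ((Matrix.of (fundWeight T l)).mulVec x) = x := by
    rw [Matrix.mulVec_mulVec, h', Matrix.one_mulVec]
  conv_rhs => rw [← h2]
  ext a
  simp [Matrix.mulVec, dotProduct, coord, mul_comm]

/-- The simple reflection `x ↦ x - (α_i^∨, x) α_i`, extended `ℂ`-linearly to `V_ℂ`. -/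
def simpleReflection (T : BCD) (l : ℕ) (i : Fin l) : VC l ≃ₗ[ℂ] VC l :=
  Module.reflection (x := simpleRoot T l i)
    (f := dotProductBilin ℂ ℂ (simpleCoroot T l i))
    (simpleCoroot_dot_simpleRoot T l i)

lemma simpleReflection_apply (T : BCD) (l : ℕ) (i : Fin l) (x : VC l) :
    simpleReflection T l i x = x - (simpleCoroot T l i ⬝ᵥ x) • simpleRoot T l i := by
  simp only [simpleReflection]
  rfl

/-- The Weyl group `W`, generated by the simple reflections. -/
def weylGroup (T : BCD) (l : ℕ) : Subgroup (VC l ≃ₗ[ℂ] VC l) :=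
  Subgroup.closure (Set.range (simpleReflection T l))

/-- The set `{± ε_a}`. -/
def unitVecs (l : ℕ) : Set (VC l) :=
  {v | ∃ a : Fin l, v = Pi.single a 1 ∨ v = - Pi.single a 1}

lemma unitVecs_finite (l : ℕ) : (unitVecs l).Finite := by
  have : unitVecs l ⊆ Set.range (fun a : Fin l => (Pi.single a 1 : VC l)) ∪
      Set.range (fun a : Fin l => - (Pi.single a 1 : VC l)) := by
    rintro v ⟨a, h | h⟩
    · exact Or.inl ⟨a, h.symm⟩
    · exact Or.inr ⟨a, h.symm⟩
  exact ((Set.finite_range _).union (Set.finite_range _)).subset this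

lemma neg_mem_unitVecs {l : ℕ} {v : VC l} (h : v ∈ unitVecs l) : -v ∈ unitVecs l := by
  obtain ⟨a, rfl | rfl⟩ := h
  · exact ⟨a, Or.inr rfl⟩
  · exact ⟨a, Or.inl (neg_neg _)⟩

lemma simpleReflection_mem_unitVecs (T : BCD) (l : ℕ) (i : Fin l) {v : VC l}
    (hv : v ∈ unitVecs l) : simpleReflection T l i v ∈ unitVecs l := by
  suffices H : ∀ a : Fin l, simpleReflection T l i (Pi.single a 1) ∈ unitVecs l by
    obtain ⟨a, rfl | rfl⟩ := hv
    · exact H a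
    · rw [map_neg]; exact neg_mem_unitVecs (H a)
  intro a
  rw [simpleReflection_apply]
  unfold simpleCoroot simpleRoot
  split_ifs with h
  · generalize hb : (⟨(i : ℕ) + 1, h⟩ : Fin l) = b
    have h1 : i ≠ b := by
      intro e; have := congrArg Fin.val (hb.trans e.symm); simp at this
    by_cases e1 : a = i
    · subst e1
      refine ⟨b, Or.inl ?_⟩
      simp [h1, h1.symm]; norm_num
    · by_cases e2 : a = b
      · subst e2
        refine ⟨i, Or.inl ?_⟩
        simp [h1, h1.symm]; norm_num
      · refine ⟨a, Or.inl ?_⟩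
        simp [e1, e2]
  · cases T
    · by_cases e1 : a = i
      · subst e1
        refine ⟨a, Or.inr ?_⟩
        ext c; by_cases hc : c = a <;> simp [hc]; norm_num
      · refine ⟨a, Or.inl ?_⟩
        simp [e1]
    · by_cases e1 : a = i
      · subst e1
        refine ⟨a, Or.inr ?_⟩
        ext c; by_cases hc : c = a <;> simp [hc]; norm_num
      · refine ⟨a, Or.inl ?_⟩
        simp [e1]
    · generalize (⟨(i : ℕ) - 1, _⟩ : Fin l) = b
      by_cases h1 : i = b
      · subst h1
        by_cases e1 : a = i
        · subst e1
          refine ⟨a, Or.inr ?_⟩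
          ext c; by_cases hc : c = a <;> simp [hc]; norm_num
        · refine ⟨a, Or.inl ?_⟩
          simp [e1]
      · have h2 : b ≠ i := fun e => h1 e.symm
        by_cases e1 : a = i
        · subst e1
          refine ⟨b, Or.inr ?_⟩
          simp [h1, h2]; norm_num
        · by_cases e2 : a = b
          · subst e2
            refine ⟨i, Or.inr ?_⟩
            simp [h1, h2]; norm_num
          · refine ⟨a, Or.inl ?_⟩
            simp [e1, e2]

lemma weylGroup_mem_unitVecs (T : BCD) (l : ℕ) (w : VC l ≃ₗ[ℂ] VC l) (hw : w ∈ weylGroup T l) :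
    ∀ v ∈ unitVecs l, w v ∈ unitVecs l := by
  induction hw using Subgroup.closure_induction with
  | mem w hw =>
    obtain ⟨i, rfl⟩ := hw
    exact fun v hv => simpleReflection_mem_unitVecs T l i hv
  | one => exact fun v hv => hv
  | mul a b _ _ ha hb => exact fun v hv => ha _ (hb _ hv)
  | inv a _ ha =>
    intro v hv
    have hf : Finite (unitVecs l) := unitVecs_finite l
    let g : unitVecs l → unitVecs l := fun u => ⟨a u, ha u u.2⟩
    have hg : Function.Injective g := fun u u' e =>
      Subtype.ext (a.injective (congrArg Subtype.val e))
    obtain ⟨u, hu⟩ := (Finite.injective_iff_surjective.mp hg) ⟨v, hv⟩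
    have hu' : a u = v := congrArg Subtype.val hu
    have : a⁻¹ v = u := by
      rw [← hu']; exact a.symm_apply_apply u
    rw [this]; exact u.2

/-- The Weyl group is finite, so that sums over `W` are genuine finite sums. -/
instance weylGroup_finite (T : BCD) (l : ℕ) : Finite (weylGroup T l) := by
  have hf : Finite (unitVecs l) := unitVecs_finite l
  let F : weylGroup T l → (Fin l → unitVecs l) := fun w a =>
    ⟨w.1 (Pi.single a 1), weylGroup_mem_unitVecs T l w.1 w.2 _ ⟨a, Or.inl rfl⟩⟩
  refine Finite.of_injective F fun w w' h => Subtype.ext ?_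
  apply LinearEquiv.toLinearMap_injective
  refine (Pi.basisFun ℂ (Fin l)).ext fun a => ?_
  have := congrArg Subtype.val (congrFun h a)
  simpa [F] using this

/-- The number `γ`: it is `2` for `B_l` with `k = l`, and `1` in all other cases. -/
def gam (T : BCD) (l : ℕ) (k : Fin l) : ℕ :=
  match T with
  | .B => if (k : ℕ) + 1 = l then 2 else 1
  | .C => 1
  | .D => 1

/-- The transformation `(𝐱, x_{l+1}) ↦ (w(𝐱) + ∑ m_j α_j^∨, x_{l+1})`. -/
def affineMap (T : BCD) (l : ℕ) (w : VC l ≃ₗ[ℂ] VC l) (m : Fin l → ℤ) :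
    Equiv.Perm (VC l × ℂ) :=
  Equiv.prodCongr
    (w.toEquiv.trans (Equiv.addRight (∑ j, (m j : ℂ) • simpleCoroot T l j))) (Equiv.refl ℂ)

/-- The transformation `(𝐱, x_{l+1}) ↦ (𝐱 + γ ω_k, x_{l+1} - γ)`. -/
def shiftMap (T : BCD) (l : ℕ) (k : Fin l) : Equiv.Perm (VC l × ℂ) :=
  Equiv.prodCongr (Equiv.addRight ((gam T l k : ℂ) • fundWeight T l k))
    (Equiv.subRight (gam T l k : ℂ))

lemma affineMap_apply (T : BCD) (l : ℕ) (w : VC l ≃ₗ[ℂ] VC l) (m : Fin l → ℤ) (p : VC l × ℂ) :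
    affineMap T l w m p = (w p.1 + ∑ j, (m j : ℂ) • simpleCoroot T l j, p.2) := rfl

lemma shiftMap_apply (T : BCD) (l : ℕ) (k : Fin l) (p : VC l × ℂ) :
    shiftMap T l k p = (p.1 + (gam T l k : ℂ) • fundWeight T l k, p.2 - gam T l k) := rfl

/-- The extended affine Weyl group `W̃^{(k)}`, acting on the complexification `V_ℂ ⊕ ℂ` of the
extended space `V ⊕ ℝ`. -/
def extWeylGroup (T : BCD) (l : ℕ) (k : Fin l) : Subgroup (Equiv.Perm (VC l × ℂ)) :=
  Subgroup.closure
    ({g | ∃ w ∈ weylGroup T l, ∃ m : Fin l → ℤ, g = affineMap T l w m} ∪ {shiftMap T l k})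

/-- The Cartan matrix `A_ij = (α_i, α_j^∨)`. -/
def cartanMatrix (T : BCD) (l : ℕ) : Matrix (Fin l) (Fin l) ℂ :=
  Matrix.of fun i j => simpleRoot T l i ⬝ᵥ simpleCoroot T l j

/-- The exponential function
`e^{2πi (m_1 x_1 + ⋯ + m_l x_l + m_{l+1} x_{l+1} / (γ f))}`, `f` being the determinant of the
Cartan matrix, as a multiplicative function of `(m_1, …, m_l; m_{l+1})`. -/
def fourierMonomial (T : BCD) (l : ℕ) (k : Fin l) :
    Multiplicative ((Fin l → ℤ) × ℤ) →* (VC l × ℂ → ℂ) where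
  toFun m p := Complex.exp (2 * Real.pi * Complex.I *
    (∑ j, (m.toAdd.1 j : ℂ) * coord T l j p.1 +
      (m.toAdd.2 : ℂ) / ((gam T l k : ℂ) * (cartanMatrix T l).det) * p.2))
  map_one' := by
    ext p
    simp
  map_mul' m n := by
    ext p
    simp only [toAdd_mul, Prod.fst_add, Prod.snd_add, Pi.add_apply, Int.cast_add, Pi.mul_apply,
      ← Complex.exp_add, add_mul, add_div, Finset.sum_add_distrib]
    congr 1
    ring

/-- The ring of Fourier polynomials, i.e. finite `ℂ`-linear combinations of the functions
`fourierMonomial`. -/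
def fourierPolynomials (T : BCD) (l : ℕ) (k : Fin l) : Subalgebra ℂ (VC l × ℂ → ℂ) :=
  (AddMonoidAlgebra.lift ℂ (VC l × ℂ → ℂ) ((Fin l → ℤ) × ℤ) (fourierMonomial T l k)).range

/-- Explicitly: `f` is a Fourier polynomial iff it is a finite sum
`∑ a_m e^{2πi (m_1 x_1 + ⋯ + m_l x_l + m_{l+1} x_{l+1} / (γ f))}`. -/
theorem mem_fourierPolynomials_iff (T : BCD) (l : ℕ) (k : Fin l) (f : VC l × ℂ → ℂ) :
    f ∈ fourierPolynomials T l k ↔ ∃ a : ((Fin l → ℤ) × ℤ) →₀ ℂ, ∀ p : VC l × ℂ,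
      f p = a.sum fun m c => c * Complex.exp (2 * Real.pi * Complex.I *
        (∑ j, (m.1 j : ℂ) * coord T l j p.1 +
          (m.2 : ℂ) / ((gam T l k : ℂ) * (cartanMatrix T l).det) * p.2)) := by
  unfold fourierPolynomials
  rw [AlgHom.mem_range]
  constructor
  · rintro ⟨a, rfl⟩
    refine ⟨a.coeff, fun p => ?_⟩
    rw [AddMonoidAlgebra.lift_apply]
    simp [Finsupp.sum, Finset.sum_apply, fourierMonomial]
  · rintro ⟨a, ha⟩
    refine ⟨.ofCoeff a, ?_⟩
    ext p
    rw [ha p, AddMonoidAlgebra.lift_apply]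
    simp [Finsupp.sum, Finset.sum_apply, fourierMonomial]

/-- The path `(𝐱⁰ - i ω_k τ, x⁰_{l+1} + i τ)`. -/
def limitPath (T : BCD) (l : ℕ) (k : Fin l) (p : VC l × ℂ) (τ : ℝ) : VC l × ℂ :=
  (p.1 - (Complex.I * τ) • fundWeight T l k, p.2 + Complex.I * τ)

/-- The ring `𝒜 = 𝒜^{(k)}` of all `W̃^{(k)}`-invariant Fourier polynomials which stay bounded
along `limitPath` as `τ → +∞`, for every starting point. -/
def ringA (T : BCD) (l : ℕ) (k : Fin l) : Subalgebra ℂ (VC l × ℂ → ℂ) where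
  carrier := {f | f ∈ fourierPolynomials T l k ∧
    (∀ g ∈ extWeylGroup T l k, ∀ p, f (g p) = f p) ∧
    ∀ p, (fun τ : ℝ => f (limitPath T l k p τ)) =O[atTop] (fun _ => (1 : ℝ))}
  mul_mem' := by
    rintro f g ⟨hf1, hf2, hf3⟩ ⟨hg1, hg2, hg3⟩
    refine ⟨mul_mem hf1 hg1, fun w hw p => ?_, fun p => ?_⟩
    · simp [hf2 w hw p, hg2 w hw p]
    · simpa using (hf3 p).mul (hg3 p)
  add_mem' := by
    rintro f g ⟨hf1, hf2, hf3⟩ ⟨hg1, hg2, hg3⟩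
    refine ⟨add_mem hf1 hg1, fun w hw p => ?_, fun p => ?_⟩
    · simp [hf2 w hw p, hg2 w hw p]
    · exact (hf3 p).add (hg3 p)
  algebraMap_mem' c := by
    refine ⟨Subalgebra.algebraMap_mem _ c, fun w hw p => rfl, fun p => ?_⟩
    exact isBigO_const_const c one_ne_zero atTop

/-- The number `d_j = (ω_j, ω_k)`. -/
def dNum (T : BCD) (l : ℕ) (k j : Fin l) : ℂ := fundWeight T l j ⬝ᵥ fundWeight T l k

/-- `n_j = #{w ∈ W | e^{2πi (ω_j, w(𝐱))} = e^{2πi (ω_j, 𝐱)}}`, the equality being one of functions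
of `𝐱`. -/
def nNum (T : BCD) (l : ℕ) (j : Fin l) : ℕ :=
  Nat.card {w : weylGroup T l // ∀ x : VC l,
    Complex.exp (2 * Real.pi * Complex.I * (fundWeight T l j ⬝ᵥ w.1 x)) =
      Complex.exp (2 * Real.pi * Complex.I * (fundWeight T l j ⬝ᵥ x))}

/-- The basic `W_a`-invariant Fourier polynomial
`y_j(𝐱) = n_j⁻¹ ∑_{w ∈ W} e^{2πi (ω_j, w(𝐱))}`. -/
def yFun (T : BCD) (l : ℕ) (j : Fin l) (x : VC l) : ℂ :=
  (1 / (nNum T l j : ℂ)) *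
    ∑ᶠ w : weylGroup T l, Complex.exp (2 * Real.pi * Complex.I * (fundWeight T l j ⬝ᵥ w.1 x))

/-- The functions `ỹ_j(x) = e^{2πi d_j x_{l+1}} y_j(𝐱)` for `j = 1, …, l`, followed by
`ỹ_{l+1}(x) = e^{(2πi/γ) x_{l+1}}`. -/
def yTilde (T : BCD) (l : ℕ) (k : Fin l) : Fin (l + 1) → (VC l × ℂ → ℂ) :=
  Fin.snoc (α := fun _ => VC l × ℂ → ℂ)
    (fun j p => Complex.exp (2 * Real.pi * Complex.I * dNum T l k j * p.2) * yFun T l j p.1)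
    (fun p => Complex.exp (2 * Real.pi * Complex.I / (gam T l k : ℂ) * p.2))

end ExtAffine

end

noncomputable section

/-! ### Leading exponents in group algebras. -/

namespace AddMonoidAlgebra

variable {K G : Type*} [Field K] [AddCommGroup G]

/-! Distinct characters are linearly independent, so a Fourier polynomial is the same thing as an
element of the group algebra of the exponent lattice ℤ^l × ℤ (`fourierLift_injective`), and all
questions become questions about supports. Exponents are compared by `height`, the pairing of the
weight with 4∑ω_k; the factor 4 makes it integral, and the last exponent plays no role in it.

The difference wω_j − ω_j is a combination of simple roots with coefficients ≤ 0
(`exists_weylGroup_fundWeight`), so ω_j is the unique highest weight in its orbit. Hence ỹ_j has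
leading exponent (ω_j, γ f d_j) and ỹ_{l+1} has (0, f). Distinct monomials in the generators have
distinct leading exponents, which gives algebraic independence.

For generation, let (λ, M) be an exponent of maximal height in an element of the ring. W-invariance
makes λ dominant, shift invariance makes γ(λ, ω_k) − M/f an integer, and boundedness makes that
integer ≤ 0. Therefore (λ, M) is an ℕ-combination of the leading exponents
(`exists_eq_sum_leadExponent`). Subtracting monomials in the generators lowers the height, and the
descent stops because leading exponents have nonnegative height.

For the limits, the term of y_j with weight wω_j grows at a rate proportional to (wω_j, ω_k) ≤ d_j,
so y_j^0 keeps exactly the terms with equality. The weight ω_j is among them and remains leading, so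
the same independence argument applies. -/

/-- `m` lies in the support of `a`, and every other element of the support has strictly smaller
height. -/
def IsLead (h : G →+ ℤ) (a : AddMonoidAlgebra K G) (m : G) : Prop :=
  a.coeff m ≠ 0 ∧ ∀ m', a.coeff m' ≠ 0 → m' ≠ m → h m' < h m

lemma IsLead.le {h : G →+ ℤ} {a : AddMonoidAlgebra K G} {m m' : G} (ha : IsLead h a m)
    (hm : a.coeff m' ≠ 0) : h m' ≤ h m := by
  by_cases e : m' = m
  · rw [e]
  · exact (ha.2 m' hm e).le

lemma IsLead.eq_of_le {h : G →+ ℤ} {a : AddMonoidAlgebra K G} {m m' : G} (ha : IsLead h a m)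
    (hm : a.coeff m' ≠ 0) (hle : h m ≤ h m') : m' = m := by
  by_contra e
  exact absurd (ha.2 m' hm e) (not_lt.mpr hle)

lemma isLead_single (h : G →+ ℤ) (m : G) {c : K} (hc : c ≠ 0) :
    IsLead h (single m c) m := by
  classical
  refine ⟨by simpa using hc, fun m' h1 h2 => absurd ?_ h1⟩
  rw [coeff_single, Finsupp.single_apply, if_neg (Ne.symm h2)]

lemma isLead_one (h : G →+ ℤ) : IsLead h (1 : AddMonoidAlgebra K G) 0 :=
  isLead_single h 0 one_ne_zero

/-- A sum of two supported exponents reaches the height of `m + n` only if both summands have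
maximal height, hence are `m` and `n`. So nothing can cancel the product of the two leading
coefficients. -/
lemma IsLead.mul {h : G →+ ℤ} {a b : AddMonoidAlgebra K G} {m n : G} (ha : IsLead h a m)
    (hb : IsLead h b n) : IsLead h (a * b) (m + n) := by
  classical
  refine ⟨?_, fun p hp hne => ?_⟩
  · rw [coeff_mul_add_of_uniqueAdd]
    · exact mul_ne_zero ha.1 hb.1
    · intro x y hx hy hxy
      rw [Finsupp.mem_support_iff] at hx hy
      have h1 := ha.le hx
      have h2 := hb.le hy
      have h3 : h x + h y = h m + h n := by rw [← map_add, hxy, map_add]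
      exact ⟨ha.eq_of_le hx (by omega), hb.eq_of_le hy (by omega)⟩
  · obtain ⟨x, hx, y, hy, rfl⟩ := Finset.mem_add.mp
      (support_coeff_mul_subset a b (Finsupp.mem_support_iff.mpr hp))
    rw [Finsupp.mem_support_iff] at hx hy
    have h1 := ha.le hx
    have h2 := hb.le hy
    rw [map_add, map_add]
    by_contra hlt
    exact hne (by rw [ha.eq_of_le hx (by omega), hb.eq_of_le hy (by omega)])

lemma IsLead.pow {h : G →+ ℤ} {a : AddMonoidAlgebra K G} {m : G} (ha : IsLead h a m) (n : ℕ) :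
    IsLead h (a ^ n) (n • m) := by
  induction n with
  | zero => simpa using isLead_one h
  | succ n ih => rw [pow_succ, succ_nsmul]; exact ih.mul ha

lemma IsLead.prod {ι : Type*} {h : G →+ ℤ} {a : ι → AddMonoidAlgebra K G} {m : ι → G}
    (s : Finset ι) (ha : ∀ i, IsLead h (a i) (m i)) :
    IsLead h (∏ i ∈ s, a i) (∑ i ∈ s, m i) := by
  classical
  induction s using Finset.induction_on with
  | empty => simpa using isLead_one h
  | insert i s hi ih => rw [Finset.prod_insert hi, Finset.sum_insert hi]; exact (ha i).mul ih

lemma isLead_aeval_monomial {n : ℕ} {h : G →+ ℤ} {Y : Fin n → AddMonoidAlgebra K G}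
    {m : Fin n → G} (hY : ∀ j, IsLead h (Y j) (m j)) (s : Fin n →₀ ℕ) :
    IsLead h (MvPolynomial.aeval Y (MvPolynomial.monomial s (1 : K))) (∑ j, s j • m j) := by
  rw [MvPolynomial.aeval_monomial, map_one, one_mul, Finsupp.prod_fintype _ _ (by simp)]
  exact IsLead.prod _ fun j => (hY j).pow _

/-- Elements with linearly independent leading exponents are algebraically independent. -/
theorem algebraicIndependent_of_isLead {n : ℕ} {h : G →+ ℤ} {Y : Fin n → AddMonoidAlgebra K G}
    {m : Fin n → G} (hY : ∀ j, IsLead h (Y j) (m j))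
    (hm : Function.Injective fun s : Fin n →₀ ℕ => ∑ j, s j • m j) :
    AlgebraicIndependent K Y := by
  rw [algebraicIndependent_iff]
  intro p hp
  by_contra hp0
  -- Ties in height are harmless: another monomial of `p` can contain this exponent only as its own
  -- leading exponent, and `hm` excludes that.
  obtain ⟨s, hs, hmax⟩ := Finset.exists_max_image p.support
    (fun s => h (∑ j, s j • m j)) (MvPolynomial.support_nonempty.mpr hp0)
  have key : ∀ q, q = ∑ j, s j • m j → (MvPolynomial.aeval Y p).coeff q =
      p.coeff s * (MvPolynomial.aeval Y (MvPolynomial.monomial s (1 : K))).coeff q := by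
    intro q hq
    conv_lhs => rw [p.as_sum]
    rw [map_sum, coeff_sum, Finsupp.finsetSum_apply, Finset.sum_eq_single s]
    · rw [show MvPolynomial.monomial s (p.coeff s) = p.coeff s • MvPolynomial.monomial s (1 : K) by
        rw [MvPolynomial.smul_monomial, smul_eq_mul, mul_one], map_smul, coeff_smul_apply,
        smul_eq_mul]
    · intro t ht hts
      rw [show MvPolynomial.monomial t (p.coeff t) = p.coeff t • MvPolynomial.monomial t (1 : K) by
        rw [MvPolynomial.smul_monomial, smul_eq_mul, mul_one], map_smul, coeff_smul_apply,
        smul_eq_mul]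
      refine mul_eq_zero_of_right _ ?_
      by_contra hne
      refine hts (hm ?_)
      have := (isLead_aeval_monomial hY t).eq_of_le hne (hq ▸ hmax t ht)
      exact (hq.symm.trans this).symm
    · exact fun hs' => absurd hs hs'
  refine mul_ne_zero (MvPolynomial.mem_support_iff.mp hs) (isLead_aeval_monomial hY s).1 ?_
  rw [← key _ rfl, hp, coeff_zero, Finsupp.zero_apply]

/-- If the exponents of maximal height of the elements of a subalgebra `B` are non-negative
combinations of the leading exponents of some elements `Y j` of `B`, then these generate `B`. -/
theorem mem_range_aeval_of_isLead {n : ℕ} {h : G →+ ℤ} {Y : Fin n → AddMonoidAlgebra K G}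
    {m : Fin n → G} (hY : ∀ j, IsLead h (Y j) (m j)) (hpos : ∀ j, 0 ≤ h (m j))
    (B : Subalgebra K (AddMonoidAlgebra K G)) (hB : ∀ j, Y j ∈ B)
    (hmax : ∀ a ∈ B, ∀ q, a.coeff q ≠ 0 → (∀ q', a.coeff q' ≠ 0 → h q' ≤ h q) →
      ∃ s : Fin n →₀ ℕ, q = ∑ j, s j • m j)
    {a : AddMonoidAlgebra K G} (ha : a ∈ B) :
    a ∈ (MvPolynomial.aeval Y : MvPolynomial (Fin n) K →ₐ[K] AddMonoidAlgebra K G).range := by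
  classical
  have hmonB : ∀ p : MvPolynomial (Fin n) K, MvPolynomial.aeval Y p ∈ B := by
    intro p
    induction p using MvPolynomial.induction_on with
    | C c => rw [MvPolynomial.algHom_C]; exact B.algebraMap_mem c
    | add p q hp hq => rw [map_add]; exact B.add_mem hp hq
    | mul_X p j hp => rw [map_mul, MvPolynomial.aeval_X]; exact B.mul_mem hp (hB j)
  -- Induction on a strict bound for the heights. At bound 0 the element vanishes, since its highest
  -- exponent would be a combination of exponents of nonnegative height.
  have main : ∀ N : ℕ, ∀ a ∈ B, (∀ q, a.coeff q ≠ 0 → h q < N) →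
      a ∈ (MvPolynomial.aeval Y : MvPolynomial (Fin n) K →ₐ[K] AddMonoidAlgebra K G).range := by
    intro N
    induction N with
    | zero =>
      intro a ha hlt
      by_cases h0 : a = 0
      · rw [h0]; exact zero_mem _
      exfalso
      have hne : a.coeff.support.Nonempty := by
        rw [Finsupp.support_nonempty_iff]; simpa using h0
      obtain ⟨q, hq, hqmax⟩ := Finset.exists_max_image a.coeff.support h hne
      rw [Finsupp.mem_support_iff] at hq
      obtain ⟨s, hs⟩ := hmax a ha q hq fun q' hq' =>
        hqmax q' (Finsupp.mem_support_iff.mpr hq')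
      have h1 := hlt q hq
      have h2 : 0 ≤ h q := by
        rw [hs, map_sum]
        refine Finset.sum_nonneg fun j _ => ?_
        rw [map_nsmul]
        exact nsmul_nonneg (hpos j) _
      simp only [Nat.cast_zero] at h1
      omega
    | succ N ih =>
      intro a ha hlt
      -- The whole top layer is removed at once: several exponents may share a height, so cancelling
      -- a single one need not lower the bound.
      set T := a.coeff.support.filter fun q => h q = N with hT
      have hex : ∀ q : G, ∃ s : Fin n →₀ ℕ, q ∈ T → q = ∑ j, s j • m j := by
        intro q
        by_cases hq : q ∈ T
        · rw [hT, Finset.mem_filter, Finsupp.mem_support_iff] at hq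
          obtain ⟨s, hs⟩ := hmax a ha q hq.1 fun q' hq' => by
            have := hlt q' hq'
            push_cast at this
            omega
          exact ⟨s, fun _ => hs⟩
        · exact ⟨0, fun h' => absurd h' hq⟩
      choose s hs using hex
      let Z : G → AddMonoidAlgebra K G := fun q =>
        MvPolynomial.aeval Y (MvPolynomial.monomial (s q) (1 : K))
      have hZ : ∀ q ∈ T, IsLead h (Z q) q := fun q hq => by
        have := isLead_aeval_monomial hY (s q)
        rwa [← hs q hq] at this
      let c : AddMonoidAlgebra K G := ∑ q ∈ T, (a.coeff q / (Z q).coeff q) • Z q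
      have hc : c ∈ (MvPolynomial.aeval Y :
          MvPolynomial (Fin n) K →ₐ[K] AddMonoidAlgebra K G).range :=
        Subalgebra.sum_mem _ fun q _ => Subalgebra.smul_mem _ (AlgHom.mem_range_self _ _) _
      have hcB : c ∈ B := Subalgebra.sum_mem _ fun q _ => Subalgebra.smul_mem _ (hmonB _) _
      have hsub := ih (a - c) (B.sub_mem ha hcB) ?_
      · have := add_mem hsub hc
        rwa [sub_add_cancel] at this
      intro p hp
      have hcp : c.coeff p = ∑ q ∈ T, (a.coeff q / (Z q).coeff q) * (Z q).coeff p := by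
        simp only [c]
        rw [coeff_sum, Finsupp.finsetSum_apply]
        simp
      by_contra hN
      rw [not_lt] at hN
      -- The correction with leading exponent `q` has no other exponent of height `N` or more, so
      -- the corrections for different `q` do not interfere.
      have hZp : ∀ q ∈ T, q ≠ p → (Z q).coeff p = 0 := by
        intro q hq hqp
        by_contra hne
        refine hqp ((hZ q hq).eq_of_le hne ?_).symm
        rw [hT, Finset.mem_filter] at hq
        omega
      apply hp
      rw [coeff_sub, Finsupp.sub_apply, hcp]
      by_cases hpT : p ∈ T
      · rw [Finset.sum_eq_single_of_mem p hpT
          (fun q hq hqp => by rw [hZp q hq hqp, mul_zero]),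
          div_mul_cancel₀ _ (hZ p hpT).1, sub_self]
      · rw [Finset.sum_eq_zero (fun q hq => by
          rw [hZp q hq (fun e => hpT (e ▸ hq)), mul_zero]), sub_zero]
        by_contra hap
        apply hpT
        have := hlt p hap
        push_cast at this
        rw [hT, Finset.mem_filter, Finsupp.mem_support_iff]
        exact ⟨hap, by omega⟩
  obtain ⟨N, hN⟩ : ∃ N : ℕ, ∀ q ∈ a.coeff.support, h q < N := by
    refine ⟨(a.coeff.support.sup fun q => (h q).toNat) + 1, fun q hq => ?_⟩
    have := Finset.le_sup (f := fun q => (h q).toNat) hq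
    push_cast
    have h2 := Int.self_le_toNat (h q)
    omega
  exact main N a ha fun q hq => hN q (Finsupp.mem_support_iff.mpr hq)

end AddMonoidAlgebra

/-! ### Root lengths, the Cartan matrix, weight and root lattices. -/

namespace ExtAffine

variable {T : BCD} {l : ℕ}

/-- The number `(α_i, α_i) / 2`. -/
def halfNormSq (T : BCD) (l : ℕ) (i : Fin l) : ℝ :=
  if (i : ℕ) + 1 < l then 1 else
    match T with
    | .B => 1 / 2
    | .C => 2
    | .D => 1

lemma halfNormSq_pos (T : BCD) (l : ℕ) (i : Fin l) : 0 < halfNormSq T l i := by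
  unfold halfNormSq
  split_ifs
  · norm_num
  · cases T <;> norm_num

/-- This is the purpose of γ: only the short simple root of `B_l` has half squared length 1/2, and
there γ = 2. -/
lemma exists_gam_mul_halfNormSq (T : BCD) (l : ℕ) (i : Fin l) :
    ∃ z : ℤ, (gam T l i : ℝ) * halfNormSq T l i = z := by
  have hi := i.isLt
  by_cases h : (i : ℕ) + 1 < l
  · have h' : (i : ℕ) + 1 ≠ l := by omega
    refine ⟨1, ?_⟩
    cases T <;> simp [halfNormSq, gam, h, h']
  · have h' : (i : ℕ) + 1 = l := by omega
    cases T
    · exact ⟨1, by simp [halfNormSq, gam, h']⟩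
    · exact ⟨2, by simp [halfNormSq, gam, h']⟩
    · exact ⟨1, by simp [halfNormSq, gam, h']⟩

lemma gam_pos (T : BCD) (l : ℕ) (k : Fin l) : 0 < gam T l k := by
  unfold gam
  cases T
  · dsimp only; split_ifs <;> norm_num
  · norm_num
  · norm_num

lemma simpleRoot_eq_smul (hl : T.minRank ≤ l) (i : Fin l) :
    simpleRoot T l i = (halfNormSq T l i : ℂ) • simpleCoroot T l i := by
  rw [simpleCoroot_eq T l hl]
  unfold simpleRoot halfNormSq
  split_ifs with h
  · simp
  · cases T
    · ext a; by_cases e : a = i <;> simp [e]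
    · ext a; by_cases e : a = i <;> simp [e]
    · simp

lemma fundWeight_dot_simpleRoot (hl : T.minRank ≤ l) (i j : Fin l) :
    fundWeight T l i ⬝ᵥ simpleRoot T l j = if i = j then (halfNormSq T l j : ℂ) else 0 := by
  rw [simpleRoot_eq_smul hl, dotProduct_smul, fundWeight_dot_simpleCoroot T l hl]
  split_ifs <;> simp

lemma exists_int_simpleRoot (T : BCD) (l : ℕ) (i : Fin l) :
    ∃ z : Fin l → ℤ, simpleRoot T l i = fun a => (z a : ℂ) := by
  unfold simpleRoot
  split_ifs with h
  · refine ⟨Pi.single i 1 - Pi.single ⟨(i : ℕ) + 1, h⟩ 1, ?_⟩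
    ext a; simp [Pi.single_apply]
  · cases T
    · exact ⟨Pi.single i 1, by ext a; simp [Pi.single_apply]⟩
    · exact ⟨Pi.single i 2, by ext a; simp [Pi.single_apply]⟩
    · refine ⟨Pi.single ⟨(i : ℕ) - 1, by omega⟩ 1 + Pi.single i 1, ?_⟩
      ext a; simp [Pi.single_apply]

lemma exists_int_simpleCoroot (hl : T.minRank ≤ l) (i : Fin l) :
    ∃ z : Fin l → ℤ, simpleCoroot T l i = fun a => (z a : ℂ) := by
  rw [simpleCoroot_eq T l hl]
  split_ifs with h
  · refine ⟨Pi.single i 1 - Pi.single ⟨(i : ℕ) + 1, h⟩ 1, ?_⟩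
    ext a; simp [Pi.single_apply]
  · cases T
    · exact ⟨Pi.single i 2, by ext a; simp [Pi.single_apply]⟩
    · exact ⟨Pi.single i 1, by ext a; simp [Pi.single_apply]⟩
    · refine ⟨Pi.single ⟨(i : ℕ) - 1, by omega⟩ 1 + Pi.single i 1, ?_⟩
      ext a; simp [Pi.single_apply]

lemma exists_int_cartanMatrix (hl : T.minRank ≤ l) :
    ∃ A : Matrix (Fin l) (Fin l) ℤ, cartanMatrix T l = A.map (fun z : ℤ => (z : ℂ)) := by
  have h : ∀ i j, ∃ z : ℤ, simpleRoot T l i ⬝ᵥ simpleCoroot T l j = z := by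
    intro i j
    obtain ⟨u, hu⟩ := exists_int_simpleRoot T l i
    obtain ⟨v, hv⟩ := exists_int_simpleCoroot hl j
    exact ⟨∑ a, u a * v a, by rw [hu, hv]; simp [dotProduct]⟩
  choose A hA using h
  exact ⟨Matrix.of A, by ext i j; simpa [cartanMatrix] using hA i j⟩

/-- The Cartan matrix with integer entries. -/
def cartanInt (hl : T.minRank ≤ l) : Matrix (Fin l) (Fin l) ℤ := (exists_int_cartanMatrix hl).choose

lemma cartanMatrix_eq_map (hl : T.minRank ≤ l) :
    cartanMatrix T l = (cartanInt hl).map (fun z : ℤ => (z : ℂ)) :=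
  (exists_int_cartanMatrix hl).choose_spec

lemma simpleRoot_dot_simpleCoroot (hl : T.minRank ≤ l) (i j : Fin l) :
    simpleRoot T l i ⬝ᵥ simpleCoroot T l j = cartanInt hl i j :=
  congrFun (congrFun (cartanMatrix_eq_map hl) i) j

lemma fundWeight_mul_simpleCoroot (hl : T.minRank ≤ l) :
    Matrix.of (fundWeight T l) * (Matrix.of (simpleCoroot T l)).transpose = 1 := by
  ext i j
  rw [Matrix.one_apply, ← fundWeight_dot_simpleCoroot T l hl i j]
  rfl

lemma eq_of_dot_simpleCoroot (hl : T.minRank ≤ l) {x y : VC l}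
    (h : ∀ j, x ⬝ᵥ simpleCoroot T l j = y ⬝ᵥ simpleCoroot T l j) : x = y := by
  have h' := mul_eq_one_comm.mp (fundWeight_mul_simpleCoroot (T := T) hl)
  have e : Matrix.mulVec (Matrix.of (simpleCoroot T l)) x =
      Matrix.mulVec (Matrix.of (simpleCoroot T l)) y := by
    ext j
    simpa [Matrix.mulVec, dotProduct_comm] using h j
  have h2 := congrArg Matrix.transpose (fundWeight_mul_simpleCoroot (T := T) hl)
  rw [Matrix.transpose_mul, Matrix.transpose_transpose, Matrix.transpose_one] at h2
  have h3 := mul_eq_one_comm.mp h2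
  rw [← Matrix.one_mulVec x, ← Matrix.one_mulVec y, ← h3, ← Matrix.mulVec_mulVec, e,
    Matrix.mulVec_mulVec]

/-- The Cartan matrix is the Gram matrix of the simple coroots with rows scaled by (α_i, α_i)/2, and
the coroot matrix is invertible because the fundamental weights are dual to it. -/
lemma cartanMatrix_det_ne_zero (hl : T.minRank ≤ l) : (cartanMatrix T l).det ≠ 0 := by
  have hC : (Matrix.of (simpleCoroot T l)).det ≠ 0 := by
    intro h0
    have := congrArg Matrix.det (fundWeight_mul_simpleCoroot (T := T) hl)
    rw [Matrix.det_mul, Matrix.det_transpose, h0, mul_zero, Matrix.det_one] at this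
    exact zero_ne_one this
  have e : cartanMatrix T l = Matrix.diagonal (fun i => (halfNormSq T l i : ℂ)) *
      (Matrix.of (simpleCoroot T l) * (Matrix.of (simpleCoroot T l)).transpose) := by
    ext i j
    rw [Matrix.diagonal_mul]
    simp only [cartanMatrix, Matrix.of_apply]
    rw [simpleRoot_eq_smul hl, smul_dotProduct, smul_eq_mul]
    rfl
  rw [e, Matrix.det_mul, Matrix.det_mul, Matrix.det_transpose, Matrix.det_diagonal]
  refine mul_ne_zero (Finset.prod_ne_zero_iff.mpr fun i _ => ?_) (mul_ne_zero hC hC)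
  exact_mod_cast (halfNormSq_pos T l i).ne'

lemma cartanInt_det_cast (hl : T.minRank ≤ l) :
    (cartanMatrix T l).det = ((cartanInt hl).det : ℂ) := by
  rw [cartanMatrix_eq_map hl]
  exact ((Int.castRingHom ℂ).map_det (cartanInt hl)).symm

lemma cartanInt_det_ne_zero (hl : T.minRank ≤ l) : (cartanInt hl).det ≠ 0 := by
  have := cartanMatrix_det_ne_zero hl
  rw [cartanInt_det_cast hl] at this
  exact_mod_cast this

/-- The weight with coordinates `u` in the basis of fundamental weights. -/
def wt (T : BCD) (l : ℕ) (u : Fin l → ℤ) : VC l := ∑ j, (u j : ℂ) • fundWeight T l j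

lemma wt_add (u v : Fin l → ℤ) : wt T l (u + v) = wt T l u + wt T l v := by
  simp [wt, add_smul, Finset.sum_add_distrib]

lemma wt_single (j : Fin l) : wt T l (Pi.single j 1) = fundWeight T l j := by
  rw [wt, Finset.sum_eq_single j]
  · simp
  · intro b _ hb; simp [hb]
  · simp

lemma wt_dot (u : Fin l → ℤ) (x : VC l) :
    wt T l u ⬝ᵥ x = ∑ j, (u j : ℂ) * (fundWeight T l j ⬝ᵥ x) := by
  simp [wt, sum_dotProduct, smul_dotProduct]

lemma wt_dot_simpleCoroot (hl : T.minRank ≤ l) (u : Fin l → ℤ) (j : Fin l) :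
    wt T l u ⬝ᵥ simpleCoroot T l j = u j := by
  simp [wt_dot, fundWeight_dot_simpleCoroot T l hl]

lemma wt_injective (hl : T.minRank ≤ l) : Function.Injective (wt T l) := by
  intro u v h
  ext j
  have := wt_dot_simpleCoroot hl u j
  rw [h, wt_dot_simpleCoroot hl] at this
  exact_mod_cast this.symm

/-- The element of the root lattice with coordinates `n` in the basis of simple roots. -/
def rt (T : BCD) (l : ℕ) (n : Fin l → ℤ) : VC l := ∑ j, (n j : ℂ) • simpleRoot T l j

lemma rt_add (u v : Fin l → ℤ) : rt T l (u + v) = rt T l u + rt T l v := by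
  simp [rt, add_smul, Finset.sum_add_distrib]

lemma rt_eq_wt (hl : T.minRank ≤ l) (n : Fin l → ℤ) :
    rt T l n = wt T l (Matrix.vecMul n (cartanInt hl)) := by
  refine eq_of_dot_simpleCoroot hl fun j => ?_
  rw [wt_dot_simpleCoroot hl]
  rw [rt, sum_dotProduct]
  simp only [smul_dotProduct, simpleRoot_dot_simpleCoroot hl]
  simp [Matrix.vecMul, dotProduct]

lemma rt_dot_fundWeight (hl : T.minRank ≤ l) (n : Fin l → ℤ) (k : Fin l) :
    rt T l n ⬝ᵥ fundWeight T l k = ((n k * halfNormSq T l k : ℝ) : ℂ) := by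
  have : ∀ j, simpleRoot T l j ⬝ᵥ fundWeight T l k =
      if k = j then (halfNormSq T l j : ℂ) else 0 := fun j => by
    rw [dotProduct_comm, fundWeight_dot_simpleRoot hl]
  simp [rt, sum_dotProduct, smul_dotProduct, this]

/-! ### The Weyl group: isometry, action on weights, signed permutations. -/

lemma simpleReflection_inv (i : Fin l) :
    (simpleReflection T l i)⁻¹ = simpleReflection T l i := by
  rw [inv_eq_iff_mul_eq_one]
  ext x : 1
  rw [LinearEquiv.mul_apply]
  simp only [simpleReflection_apply, dotProduct_sub, dotProduct_smul,
    simpleCoroot_dot_simpleRoot, smul_eq_mul]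
  rw [sub_sub, ← add_smul]
  ring_nf
  simp

/-- Simple reflections are involutions, so inverses of generators need no separate case. -/
lemma weylGroup_induction {P : (VC l ≃ₗ[ℂ] VC l) → Prop} (h1 : P 1)
    (hs : ∀ i w, P w → P (simpleReflection T l i * w)) :
    ∀ w ∈ weylGroup T l, P w := by
  intro w hw
  induction hw using Subgroup.closure_induction_left with
  | one => exact h1
  | mul_left x hx y _ hy => obtain ⟨i, rfl⟩ := hx; exact hs i y hy
  | inv_mul_cancel x hx y _ hy =>
    obtain ⟨i, rfl⟩ := hx
    rw [simpleReflection_inv]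
    exact hs i y hy

lemma simpleReflection_dot (i : Fin l) (x y : VC l) :
    simpleReflection T l i x ⬝ᵥ simpleReflection T l i y = x ⬝ᵥ y := by
  have h := simpleRoot_dot_self_ne_zero T l i
  simp only [simpleReflection_apply, simpleCoroot, dotProduct_sub, sub_dotProduct, smul_dotProduct,
    dotProduct_smul, smul_eq_mul]
  rw [dotProduct_comm x (simpleRoot T l i)]
  field_simp
  ring

lemma weylGroup_dot {w : VC l ≃ₗ[ℂ] VC l} (hw : w ∈ weylGroup T l) :
    ∀ x y : VC l, w x ⬝ᵥ w y = x ⬝ᵥ y := by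
  refine weylGroup_induction (P := fun w => ∀ x y : VC l, w x ⬝ᵥ w y = x ⬝ᵥ y)
    (fun x y => rfl) (fun i w h x y => ?_) w hw
  rw [LinearEquiv.mul_apply, LinearEquiv.mul_apply, simpleReflection_dot, h]

lemma weylGroup_dot_inv {w : VC l ≃ₗ[ℂ] VC l} (hw : w ∈ weylGroup T l) (x y : VC l) :
    x ⬝ᵥ w y = w⁻¹ x ⬝ᵥ y := by
  rw [← weylGroup_dot hw (w⁻¹ x) y]
  congr 1
  exact (w.apply_symm_apply x).symm

lemma simpleReflection_wt (hl : T.minRank ≤ l) (i : Fin l) (u : Fin l → ℤ) :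
    simpleReflection T l i (wt T l u) = wt T l u + rt T l (Pi.single i (-u i)) := by
  rw [simpleReflection_apply, dotProduct_comm, wt_dot_simpleCoroot hl, sub_eq_add_neg]
  congr 1
  rw [rt, Finset.sum_eq_single i]
  · simp
  · intro b _ hb; simp [hb]
  · simp

/-- Each simple reflection moves a weight by an integer multiple of a simple root, and roots are
weights, so the changes accumulate in the root lattice. -/
lemma weylGroup_wt (hl : T.minRank ≤ l) {w : VC l ≃ₗ[ℂ] VC l} (hw : w ∈ weylGroup T l) :
    ∀ u : Fin l → ℤ, ∃ n : Fin l → ℤ, w (wt T l u) = wt T l u + rt T l n := by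
  refine weylGroup_induction
    (P := fun w => ∀ u : Fin l → ℤ, ∃ n : Fin l → ℤ, w (wt T l u) = wt T l u + rt T l n)
    (fun u => ⟨0, by simp [rt]⟩) (fun i w h u => ?_) w hw
  obtain ⟨n, hn⟩ := h u
  rw [LinearEquiv.mul_apply, hn, rt_eq_wt hl, ← wt_add, simpleReflection_wt hl, wt_add,
    ← rt_eq_wt hl, add_assoc, ← rt_add]
  exact ⟨_, rfl⟩

/-- Prepares the rearrangement inequality. The parity of the signs in type `D` is not recorded;
integrality of root coordinates replaces it in `exists_weylGroup_fundWeight`. -/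
lemma simpleReflection_signed_perm (hl : T.minRank ≤ l) (i : Fin l) :
    ∃ (σ : Equiv.Perm (Fin l)) (ε : Fin l → ℝ), (∀ b, |ε b| = 1) ∧
      ∀ x b, simpleReflection T l i x b = (ε b : ℂ) * x (σ b) := by
  simp only [simpleReflection_apply, simpleCoroot_eq T l hl]
  unfold simpleRoot
  split_ifs with h
  · generalize hb : (⟨(i : ℕ) + 1, h⟩ : Fin l) = c
    have h1 : i ≠ c := by
      intro e; have := congrArg Fin.val (hb.trans e.symm); simp at this
    refine ⟨Equiv.swap i c, 1, by simp, fun x b => ?_⟩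
    by_cases e1 : b = i
    · subst e1; simp [sub_dotProduct, h1]
    · by_cases e2 : b = c
      · subst e2; simp [sub_dotProduct, e1]
      · simp [sub_dotProduct, e1, e2, Equiv.swap_apply_of_ne_of_ne]
  · cases T
    · refine ⟨1, Function.update 1 i (-1), fun b => ?_, fun x b => ?_⟩
      · by_cases e : b = i <;> simp [e]
      · by_cases e : b = i
        · subst e; simp; ring
        · simp [e]
    · refine ⟨1, Function.update 1 i (-1), fun b => ?_, fun x b => ?_⟩
      · by_cases e : b = i <;> simp [e]
      · by_cases e : b = i
        · subst e; simp; ring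
        · simp [e]
    · have h1 : (⟨(i : ℕ) - 1, by omega⟩ : Fin l) ≠ i := by
        intro e; have := congrArg Fin.val e
        simp only [BCD.minRank] at hl; simp at this; omega
      simp only
      generalize (⟨(i : ℕ) - 1, _⟩ : Fin l) = c at h1 ⊢
      refine ⟨Equiv.swap i c, Function.update (Function.update 1 i (-1)) c (-1), fun b => ?_,
        fun x b => ?_⟩
      · by_cases e1 : b = i <;> by_cases e2 : b = c <;> simp [e1, e2, Function.update_apply]
      · by_cases e1 : b = i
        · subst e1; simp [add_dotProduct, h1.symm]
        · by_cases e2 : b = c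
          · subst e2; simp [add_dotProduct, e1]
          · simp [add_dotProduct, e1, e2, Equiv.swap_apply_of_ne_of_ne]

lemma weylGroup_signed_perm (hl : T.minRank ≤ l) {w : VC l ≃ₗ[ℂ] VC l} (hw : w ∈ weylGroup T l) :
    ∃ (σ : Equiv.Perm (Fin l)) (ε : Fin l → ℝ), (∀ b, |ε b| = 1) ∧
      ∀ x b, w x b = (ε b : ℂ) * x (σ b) := by
  refine weylGroup_induction (P := fun w => ∃ (σ : Equiv.Perm (Fin l)) (ε : Fin l → ℝ),
    (∀ b, |ε b| = 1) ∧ ∀ x b, w x b = (ε b : ℂ) * x (σ b))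
    ⟨1, 1, by simp, by simp⟩ (fun i w h => ?_) w hw
  obtain ⟨σ, ε, hε, hx⟩ := h
  obtain ⟨σ', ε', hε', hx'⟩ := simpleReflection_signed_perm hl i
  refine ⟨σ'.trans σ, fun b => ε' b * ε (σ' b), fun b => by rw [abs_mul, hε, hε', one_mul],
    fun x b => ?_⟩
  rw [LinearEquiv.mul_apply, hx', hx]
  push_cast
  rw [mul_assoc]
  rfl

/-! ### Inner products of fundamental weights, dominance and integrality. -/

/-- The fundamental weights as real vectors. -/
def fundWeightReal (T : BCD) (l : ℕ) (i : Fin l) : Fin l → ℝ := fun a =>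
  match T with
  | .B => if (i : ℕ) + 1 < l then (if a ≤ i then 1 else 0) else 1 / 2
  | .C => if a ≤ i then 1 else 0
  | .D =>
      if (i : ℕ) + 2 < l then (if a ≤ i then 1 else 0)
      else if (i : ℕ) + 1 < l then (if (a : ℕ) + 1 < l then 1 / 2 else -1 / 2)
      else 1 / 2

lemma fundWeight_eq_ofReal (T : BCD) (l : ℕ) (i a : Fin l) :
    fundWeight T l i a = (fundWeightReal T l i a : ℂ) := by
  unfold fundWeight fundWeightReal
  cases T <;> dsimp only <;> split_ifs <;> norm_num

/-- The inner product `(ω_j, ω_k)` as a real number. -/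
def weightInner (T : BCD) (l : ℕ) (j k : Fin l) : ℝ :=
  ∑ a, fundWeightReal T l j a * fundWeightReal T l k a

lemma dNum_eq_ofReal (T : BCD) (l : ℕ) (k j : Fin l) : dNum T l k j = (weightInner T l j k : ℂ) := by
  simp [dNum, weightInner, dotProduct, fundWeight_eq_ofReal]

lemma fundWeight_dot_fundWeight (j k : Fin l) :
    fundWeight T l j ⬝ᵥ fundWeight T l k = (weightInner T l j k : ℂ) := dNum_eq_ofReal T l k j

lemma antitone_abs_fundWeightReal (i : Fin l) :
    Antitone fun a => |fundWeightReal T l i a| := by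
  intro a b hab
  have hab' : (a : ℕ) ≤ b := hab
  unfold fundWeightReal
  cases T <;> dsimp only <;> split_ifs <;> simp only [Fin.le_def] at * <;>
    first | omega | norm_num [abs_of_pos, abs_of_neg]

/-- Half-integrality of the entries. -/
lemma exists_int_two_mul_fundWeightReal (i a : Fin l) :
    ∃ z : ℤ, 2 * fundWeightReal T l i a = z := by
  unfold fundWeightReal
  cases T <;> dsimp only <;> split_ifs <;>
    first
    | (refine ⟨0, ?_⟩; norm_num; done)
    | (refine ⟨1, ?_⟩; norm_num; done)
    | (refine ⟨2, ?_⟩; norm_num; done)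
    | (refine ⟨-1, ?_⟩; norm_num)

lemma abs_mul_abs_eq_of_ne_D (hT : T ≠ .D) (j k : Fin l) :
    ∑ a, |fundWeightReal T l j a| * |fundWeightReal T l k a| = weightInner T l j k := by
  refine Finset.sum_congr rfl fun a _ => ?_
  have h : ∀ i, |fundWeightReal T l i a| = fundWeightReal T l i a := fun i => by
    refine abs_of_nonneg ?_
    unfold fundWeightReal
    cases T <;> dsimp only
    · split_ifs <;> norm_num
    · split_ifs <;> norm_num
    · exact absurd rfl hT
  rw [h, h]

/-- Only the last coordinate can be negative, and the product there is at least −1/4, so passing to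
absolute values adds at most 1/2. -/
lemma abs_mul_abs_le_of_D (hl : BCD.D.minRank ≤ l) (j k : Fin l) :
    ∑ a, |fundWeightReal .D l j a| * |fundWeightReal .D l k a| ≤ weightInner .D l j k + 1 / 2 := by
  simp only [BCD.minRank] at hl
  have h : ∀ a : Fin l, |fundWeightReal .D l j a| * |fundWeightReal .D l k a| ≤
      fundWeightReal .D l j a * fundWeightReal .D l k a +
        if a = (⟨l - 1, by omega⟩ : Fin l) then 1 / 2 else 0 := by
    intro a
    unfold fundWeightReal
    have hj := j.isLt
    have hk := k.isLt
    have ha := a.isLt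
    simp only [Fin.le_def, Fin.ext_iff]
    split_ifs <;> first | omega | norm_num [abs_of_pos, abs_of_neg]
  calc _ ≤ ∑ a : Fin l, (fundWeightReal .D l j a * fundWeightReal .D l k a +
        if a = (⟨l - 1, by omega⟩ : Fin l) then 1 / 2 else 0) := Finset.sum_le_sum fun a _ => h a
    _ = _ := by rw [Finset.sum_add_distrib]; simp [weightInner]

/-- In type `D` all first coordinates are at least 1/2, so the first product offsets the only
possible negative one, −1/4 in the last coordinate. -/
lemma weightInner_nonneg (hl : T.minRank ≤ l) (j k : Fin l) : 0 ≤ weightInner T l j k := by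
  by_cases hT : T = .D
  · subst hT
    have hl' := hl
    simp only [BCD.minRank] at hl'
    have h : ∀ a : Fin l, (if a = (⟨0, by omega⟩ : Fin l) then (1 / 4 : ℝ) else 0) +
        (if a = (⟨l - 1, by omega⟩ : Fin l) then (-1 / 4 : ℝ) else 0) ≤
        fundWeightReal .D l j a * fundWeightReal .D l k a := by
      intro a
      unfold fundWeightReal
      have hj := j.isLt
      have hk := k.isLt
      have ha := a.isLt
      simp only [Fin.le_def, Fin.ext_iff]
      split_ifs <;> first | omega | norm_num
    refine le_trans (le_of_eq ?_) (Finset.sum_le_sum fun a _ => h a)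
    rw [Finset.sum_add_distrib]
    simp
    norm_num
  · rw [← abs_mul_abs_eq_of_ne_D hT]
    exact Finset.sum_nonneg fun a _ => mul_nonneg (abs_nonneg _) (abs_nonneg _)

/-- The orbit of a fundamental weight lies below it in the dominance order. -/
theorem exists_weylGroup_fundWeight (hl : T.minRank ≤ l) {w : VC l ≃ₗ[ℂ] VC l}
    (hw : w ∈ weylGroup T l) (j : Fin l) :
    ∃ n : Fin l → ℤ, (∀ i, n i ≤ 0) ∧ w (fundWeight T l j) = fundWeight T l j + rt T l n := by
  obtain ⟨n, hn⟩ := weylGroup_wt hl hw (Pi.single j 1)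
  rw [wt_single] at hn
  refine ⟨n, fun k => ?_, hn⟩
  obtain ⟨σ, ε, hε, hx⟩ := weylGroup_signed_perm hl hw
  have h1 : (w (fundWeight T l j) ⬝ᵥ fundWeight T l k) =
      ((∑ b, ε b * fundWeightReal T l j (σ b) * fundWeightReal T l k b : ℝ) : ℂ) := by
    simp [dotProduct, hx, fundWeight_eq_ofReal]
  rw [hn, add_dotProduct, rt_dot_fundWeight hl, fundWeight_dot_fundWeight, ← Complex.ofReal_add,
    Complex.ofReal_inj] at h1
  -- Rearrangement inequality: the absolute values of both weights decrease along the coordinates,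
  -- so the identity permutation gives the largest sum.
  have h2 : ∑ b, ε b * fundWeightReal T l j (σ b) * fundWeightReal T l k b ≤
      ∑ b, |fundWeightReal T l j b| * |fundWeightReal T l k b| := by
    calc _ ≤ ∑ b, |fundWeightReal T l k b| * |fundWeightReal T l j (σ b)| := by
          refine Finset.sum_le_sum fun b _ => (le_abs_self _).trans (le_of_eq ?_)
          rw [abs_mul, abs_mul, hε, one_mul, mul_comm]
      _ ≤ ∑ b, |fundWeightReal T l k b| * |fundWeightReal T l j b| :=
          ((antitone_abs_fundWeightReal k).monovary
            (antitone_abs_fundWeightReal j)).sum_mul_comp_perm_le_sum_mul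
      _ = _ := Finset.sum_congr rfl fun b _ => mul_comm _ _
  by_cases hT : T = .D
  · subst hT
    -- The bound only gives `n k ≤ 1/2`, but `n k` is an integer.
    have h3 := abs_mul_abs_le_of_D hl j k
    have h4 : halfNormSq .D l k = 1 := by unfold halfNormSq; split_ifs <;> rfl
    rw [h4] at h1
    have h5 : (n k : ℝ) < ((1 : ℤ) : ℝ) := by push_cast; linarith
    have := Int.cast_lt.mp h5
    omega
  · rw [abs_mul_abs_eq_of_ne_D hT] at h2
    have h3 : (n k : ℝ) * halfNormSq T l k ≤ 0 := by linarith
    have h4 : (n k : ℝ) ≤ 0 := nonpos_of_mul_nonpos_left h3 (halfNormSq_pos T l k)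
    exact_mod_cast h4

/-- The products `γ f (ω_j, ω_k)` are integers. -/
lemma exists_int_gam_mul_det_mul_weightInner (hl : T.minRank ≤ l) (j k : Fin l) :
    ∃ z : ℤ, (gam T l k : ℝ) * (cartanInt hl).det * weightInner T l j k = z := by
  obtain ⟨g, hg⟩ := exists_gam_mul_halfNormSq T l k
  let A : Matrix (Fin l) (Fin l) ℝ := (cartanInt hl).map (fun z : ℤ => (z : ℝ))
  have hroot : ∀ i, ∑ j, A i j * weightInner T l j k = if i = k then halfNormSq T l k else 0 := by
    intro i
    have h1 : simpleRoot T l i = wt T l (cartanInt hl i) :=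
      eq_of_dot_simpleCoroot hl fun j => by
        rw [wt_dot_simpleCoroot hl, simpleRoot_dot_simpleCoroot hl]
    have h2 := fundWeight_dot_simpleRoot hl k i
    rw [dotProduct_comm, h1, wt_dot] at h2
    simp only [fundWeight_dot_fundWeight] at h2
    apply Complex.ofReal_injective
    rw [Complex.ofReal_sum]
    by_cases hik : i = k
    · subst hik; simpa [A] using h2
    · rw [if_neg (Ne.symm hik)] at h2
      simpa [A, hik] using h2
  have hvec : A.mulVec (fun j => weightInner T l j k) =
      fun i => if i = k then halfNormSq T l k else 0 := funext hroot
  -- Cramer's rule: f (ω_j, ω_k) is the adjugate entry times (α_k, α_k)/2, and γ clears the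
  -- remaining denominator.
  have h3 := congrArg (A.adjugate.mulVec) hvec
  rw [Matrix.mulVec_mulVec, Matrix.adjugate_mul, Matrix.smul_mulVec, Matrix.one_mulVec] at h3
  have h4 := congrFun h3 j
  have hdet : A.det = ((cartanInt hl).det : ℝ) :=
    ((Int.castRingHom ℝ).map_det (cartanInt hl)).symm
  have hadj : A.adjugate j k = (((cartanInt hl).adjugate j k : ℤ) : ℝ) := by
    have := (Int.castRingHom ℝ).map_adjugate (cartanInt hl)
    exact (congrFun (congrFun this j) k).symm
  simp only [Pi.smul_apply, smul_eq_mul, Matrix.mulVec, dotProduct, mul_ite, mul_zero,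
    Finset.sum_ite_eq', Finset.mem_univ, if_true] at h4
  refine ⟨(cartanInt hl).adjugate j k * g, ?_⟩
  rw [← hdet, mul_assoc, h4, hadj]
  push_cast
  rw [← hg]
  ring

/-- The products `4 (ω_j, ω_k)` are integers. -/
lemma exists_int_four_mul_weightInner (j k : Fin l) :
    ∃ z : ℤ, 4 * weightInner T l j k = z := by
  have h : ∀ a : Fin l, ∃ z : ℤ,
      4 * (fundWeightReal T l j a * fundWeightReal T l k a) = z := fun a => by
    obtain ⟨x, hx⟩ := exists_int_two_mul_fundWeightReal (T := T) j a
    obtain ⟨y, hy⟩ := exists_int_two_mul_fundWeightReal (T := T) k a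
    exact ⟨x * y, by push_cast; rw [← hx, ← hy]; ring⟩
  choose z hz using h
  refine ⟨∑ a, z a, ?_⟩
  rw [weightInner, Finset.mul_sum]
  push_cast
  exact Finset.sum_congr rfl fun a _ => hz a

/-! ### Growth and linear independence of Fourier monomials. -/

/-- The pairing `(∑ u_i ω_i, ω_k)` as a real number. -/
def weightPair (T : BCD) (l : ℕ) (u : Fin l → ℤ) (k : Fin l) : ℝ :=
  ∑ i, (u i : ℝ) * weightInner T l i k

lemma weightPair_add (u v : Fin l → ℤ) (k : Fin l) :
    weightPair T l (u + v) k = weightPair T l u k + weightPair T l v k := by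
  simp [weightPair, add_mul, Finset.sum_add_distrib]

lemma weightPair_single (j k : Fin l) :
    weightPair T l (Pi.single j 1) k = weightInner T l j k := by
  rw [weightPair, Finset.sum_eq_single j]
  · simp
  · intro b _ hb; simp [hb]
  · simp

lemma wt_dot_fundWeight (u : Fin l → ℤ) (k : Fin l) :
    wt T l u ⬝ᵥ fundWeight T l k = (weightPair T l u k : ℂ) := by
  simp [wt_dot, fundWeight_dot_fundWeight, weightPair]

lemma weightPair_vecMul (hl : T.minRank ≤ l) (n : Fin l → ℤ) (k : Fin l) :
    weightPair T l (Matrix.vecMul n (cartanInt hl)) k = n k * halfNormSq T l k := by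
  have := rt_dot_fundWeight hl n k
  rw [rt_eq_wt hl, wt_dot_fundWeight] at this
  exact_mod_cast this

/-- The growth rate of the exponential function with exponent `m` along `limitPath`. -/
def growth (T : BCD) (l : ℕ) (hl : T.minRank ≤ l) (k : Fin l) (m : (Fin l → ℤ) × ℤ) : ℝ :=
  weightPair T l m.1 k - m.2 / ((gam T l k : ℝ) * (cartanInt hl).det)

lemma fourierMonomial_apply (hl : T.minRank ≤ l) (k : Fin l) (m : (Fin l → ℤ) × ℤ)
    (p : VC l × ℂ) :
    fourierMonomial T l k (Multiplicative.ofAdd m) p =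
      Complex.exp (2 * Real.pi * Complex.I * (wt T l m.1 ⬝ᵥ p.1 +
        (m.2 : ℂ) / ((gam T l k : ℂ) * ((cartanInt hl).det : ℂ)) * p.2)) := by
  rw [← cartanInt_det_cast, wt_dot]
  rfl

lemma fourierMonomial_limitPath (hl : T.minRank ≤ l) (k : Fin l) (m : (Fin l → ℤ) × ℤ)
    (p : VC l × ℂ) (τ : ℝ) :
    fourierMonomial T l k (Multiplicative.ofAdd m) (limitPath T l k p τ) =
      fourierMonomial T l k (Multiplicative.ofAdd m) p *
        Complex.exp ((2 * Real.pi * growth T l hl k m * τ : ℝ) : ℂ) := by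
  rw [fourierMonomial_apply hl, fourierMonomial_apply hl, ← Complex.exp_add]
  congr 1
  simp only [limitPath, dotProduct_sub, dotProduct_smul, wt_dot_fundWeight, smul_eq_mul, growth]
  generalize (cartanInt hl).det = D
  push_cast
  linear_combination (-(2 * Real.pi * τ * (weightPair T l m.1 k : ℂ)) + 2 * Real.pi * τ *
    ((m.2 : ℂ) / ((gam T l k : ℂ) * (D : ℂ)))) * Complex.I_sq

lemma exp_two_pi_mul_int {z : ℂ} (n : ℤ) (h : z = n) :
    Complex.exp (2 * Real.pi * Complex.I * z) = 1 :=
  Complex.exp_eq_one_iff.mpr ⟨n, by rw [h]; ring⟩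

lemma exists_int_of_exp_two_pi_eq_one {z : ℂ}
    (h : Complex.exp (2 * Real.pi * Complex.I * z) = 1) : ∃ n : ℤ, z = n := by
  obtain ⟨n, hn⟩ := Complex.exp_eq_one_iff.mp h
  refine ⟨n, mul_left_cancel₀ Complex.two_pi_I_ne_zero (hn.trans (mul_comm _ _))⟩

/-- An additive function on the line whose exponential is trivial vanishes. -/
lemma eq_zero_of_exp_mul_eq_one {z : ℂ}
    (h : ∀ t : ℂ, Complex.exp (2 * Real.pi * Complex.I * (z * t)) = 1) : z = 0 := by
  by_contra hz
  -- This choice makes `z * t` equal to 1/2, which is not an integer.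
  obtain ⟨n, hn⟩ := exists_int_of_exp_two_pi_eq_one (h (1 / (2 * z)))
  have h2 : ((1 : ℤ) : ℂ) = ((2 * n : ℤ) : ℂ) := by
    push_cast
    rw [← hn]
    field_simp
  have := Int.cast_injective h2
  omega

lemma gam_mul_det_ne_zero (hl : T.minRank ≤ l) (k : Fin l) :
    (gam T l k : ℂ) * ((cartanInt hl).det : ℂ) ≠ 0 := by
  refine mul_ne_zero ?_ ?_
  · exact_mod_cast (gam_pos T l k).ne'
  · exact_mod_cast cartanInt_det_ne_zero hl

lemma fourierMonomial_injective (hl : T.minRank ≤ l) (k : Fin l) {m m' : (Fin l → ℤ) × ℤ}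
    (h : fourierMonomial T l k (Multiplicative.ofAdd m) =
      fourierMonomial T l k (Multiplicative.ofAdd m')) : m = m' := by
  have key : ∀ p : VC l × ℂ, Complex.exp (2 * Real.pi * Complex.I *
      ((wt T l m.1 ⬝ᵥ p.1 - wt T l m'.1 ⬝ᵥ p.1) +
        ((m.2 : ℂ) - m'.2) / ((gam T l k : ℂ) * ((cartanInt hl).det : ℂ)) * p.2)) = 1 := by
    intro p
    have := congrFun h p
    rw [fourierMonomial_apply hl, fourierMonomial_apply hl] at this
    rw [← div_eq_one_iff_eq (Complex.exp_ne_zero _), ← Complex.exp_sub] at this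
    rw [← this]
    congr 1
    ring
  ext i
  · have h0 : ((m.1 i : ℂ) - m'.1 i) = 0 := by
      refine eq_zero_of_exp_mul_eq_one fun t => ?_
      have := key (t • simpleCoroot T l i, 0)
      simp only [dotProduct_smul, wt_dot_simpleCoroot hl, mul_zero, add_zero, smul_eq_mul] at this
      rw [← this]
      congr 1
      ring
    rw [sub_eq_zero] at h0
    exact_mod_cast h0
  · have h0 : ((m.2 : ℂ) - m'.2) / ((gam T l k : ℂ) * ((cartanInt hl).det : ℂ)) = 0 := by
      refine eq_zero_of_exp_mul_eq_one fun t => ?_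
      simpa using key (0, t)
    rw [div_eq_zero_iff, or_iff_left (gam_mul_det_ne_zero hl k), sub_eq_zero] at h0
    exact_mod_cast h0

/-- A Fourier monomial as a character of the additive group `V_ℂ ⊕ ℂ`. -/
def fourierCharacter (T : BCD) (l : ℕ) (k : Fin l) (m : (Fin l → ℤ) × ℤ) :
    Multiplicative (VC l × ℂ) →* ℂ where
  toFun p := fourierMonomial T l k (Multiplicative.ofAdd m) p.toAdd
  map_one' := by
    simp [fourierMonomial, coord]
  map_mul' p q := by
    simp only [fourierMonomial, MonoidHom.coe_mk, OneHom.coe_mk, toAdd_mul, Prod.fst_add,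
      Prod.snd_add, coord, dotProduct_add, ← Complex.exp_add, mul_add, Finset.sum_add_distrib]
    congr 1
    ring

/-- Dedekind's theorem on linear independence of distinct characters. -/
lemma eq_zero_of_sum_fourierMonomial (hl : T.minRank ≤ l) (k : Fin l)
    (s : Finset ((Fin l → ℤ) × ℤ)) (g : (Fin l → ℤ) × ℤ → ℂ)
    (h : ∀ p, ∑ m ∈ s, g m * fourierMonomial T l k (Multiplicative.ofAdd m) p = 0) :
    ∀ m ∈ s, g m = 0 := by
  have hinj : Function.Injective (fourierCharacter T l k) := by
    intro m m' e
    refine fourierMonomial_injective hl k (funext fun p => ?_)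
    exact DFunLike.congr_fun e (Multiplicative.ofAdd p)
  have hli := (linearIndependent_monoidHom (Multiplicative (VC l × ℂ)) ℂ).comp _ hinj
  refine linearIndependent_iff'.mp hli s g ?_
  ext p
  simpa [fourierCharacter, Finset.sum_apply] using h p.toAdd

/-- The algebra homomorphism from formal to actual Fourier polynomials. -/
abbrev fourierLift (T : BCD) (l : ℕ) (k : Fin l) :
    AddMonoidAlgebra ℂ ((Fin l → ℤ) × ℤ) →ₐ[ℂ] (VC l × ℂ → ℂ) :=
  AddMonoidAlgebra.lift ℂ (VC l × ℂ → ℂ) ((Fin l → ℤ) × ℤ) (fourierMonomial T l k)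

lemma fourierLift_apply (k : Fin l) (a : AddMonoidAlgebra ℂ ((Fin l → ℤ) × ℤ)) (p : VC l × ℂ) :
    fourierLift T l k a p = ∑ m ∈ a.coeff.support,
      a.coeff m * fourierMonomial T l k (Multiplicative.ofAdd m) p := by
  rw [fourierLift, AddMonoidAlgebra.lift_apply]
  simp [Finsupp.sum, Finset.sum_apply]

lemma fourierLift_injective (hl : T.minRank ≤ l) (k : Fin l) :
    Function.Injective (fourierLift T l k) := by
  rw [injective_iff_map_eq_zero]
  intro a ha
  ext m
  by_contra hm
  exact hm (eq_zero_of_sum_fourierMonomial hl k a.coeff.support a.coeff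
    (fun p => by rw [← fourierLift_apply, ha]; rfl) m (Finsupp.mem_support_iff.mpr hm))

lemma tendsto_exp_two_pi_mul {δ : ℝ} (hδ : δ ≤ 0) :
    Tendsto (fun τ : ℝ => Complex.exp ((2 * Real.pi * δ * τ : ℝ) : ℂ)) atTop
      (𝓝 (if δ = 0 then 1 else 0)) := by
  split_ifs with h
  · simp [h]
  · have hlt : 2 * Real.pi * δ < 0 := by
      have := lt_of_le_of_ne hδ h
      have := Real.pi_pos
      exact mul_neg_of_pos_of_neg (by positivity) (by assumption)
    have h1 : Tendsto (fun τ : ℝ => 2 * Real.pi * δ * τ) atTop atBot :=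
      tendsto_id.const_mul_atTop_of_neg hlt
    have h2 := (Complex.continuous_ofReal.tendsto 0).comp (Real.tendsto_exp_atBot.comp h1)
    simpa [Function.comp_def] using h2

lemma isBigO_fourierLift (hl : T.minRank ≤ l) (k : Fin l)
    {a : AddMonoidAlgebra ℂ ((Fin l → ℤ) × ℤ)}
    (ha : ∀ m, a.coeff m ≠ 0 → growth T l hl k m ≤ 0) (p : VC l × ℂ) :
    (fun τ : ℝ => fourierLift T l k a (limitPath T l k p τ)) =O[atTop] (fun _ => (1 : ℝ)) := by
  simp only [fourierLift_apply, fourierMonomial_limitPath hl]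
  refine IsBigO.fun_sum fun m hm => ?_
  have h := (tendsto_exp_two_pi_mul (ha m (Finsupp.mem_support_iff.mp hm))).isBigO_one ℝ
  simpa only [mul_assoc] using
    (h.const_mul_left (fourierMonomial T l k (Multiplicative.ofAdd m) p)).const_mul_left
      (a.coeff m)

/-- If the largest growth rate were positive, dividing by that exponential would send a bounded
function to 0. The same quotient tends to the part of `a` of maximal growth, which would then vanish
at every starting point, against linear independence. -/
lemma growth_nonpos_of_isBigO (hl : T.minRank ≤ l) (k : Fin l)
    {a : AddMonoidAlgebra ℂ ((Fin l → ℤ) × ℤ)}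
    (ha : ∀ p, (fun τ : ℝ => fourierLift T l k a (limitPath T l k p τ)) =O[atTop]
      (fun _ => (1 : ℝ)))
    (m : (Fin l → ℤ) × ℤ) (hm : a.coeff m ≠ 0) : growth T l hl k m ≤ 0 := by
  by_contra hpos
  rw [not_le] at hpos
  obtain ⟨q, hq, hmax⟩ := Finset.exists_max_image a.coeff.support (growth T l hl k)
    ⟨m, Finsupp.mem_support_iff.mpr hm⟩
  have hN : 0 < growth T l hl k q := hpos.trans_le (hmax m (Finsupp.mem_support_iff.mpr hm))
  have h0 := eq_zero_of_sum_fourierMonomial hl k a.coeff.support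
    (fun r => if growth T l hl k r - growth T l hl k q = 0 then a.coeff r else 0) ?_ q hq
  · rw [sub_self, if_pos rfl] at h0
    exact (Finsupp.mem_support_iff.mp hq) h0
  intro p
  have h1 : Tendsto (fun τ : ℝ => Complex.exp ((2 * Real.pi * (-growth T l hl k q) * τ : ℝ) : ℂ) *
      fourierLift T l k a (limitPath T l k p τ)) atTop
      (𝓝 (∑ r ∈ a.coeff.support,
        (if growth T l hl k r - growth T l hl k q = 0 then a.coeff r else 0) *
          fourierMonomial T l k (Multiplicative.ofAdd r) p)) := by
    have h2 : ∀ r ∈ a.coeff.support, Tendsto (fun τ : ℝ =>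
        a.coeff r * fourierMonomial T l k (Multiplicative.ofAdd r) p *
          Complex.exp ((2 * Real.pi * (growth T l hl k r - growth T l hl k q) * τ : ℝ) : ℂ)) atTop
        (𝓝 ((if growth T l hl k r - growth T l hl k q = 0 then a.coeff r else 0) *
          fourierMonomial T l k (Multiplicative.ofAdd r) p)) := by
      intro r hr
      have := (tendsto_exp_two_pi_mul (sub_nonpos.mpr (hmax r hr))).const_mul
        (a.coeff r * fourierMonomial T l k (Multiplicative.ofAdd r) p)
      convert this using 2
      split_ifs <;> simp
    refine (tendsto_finsetSum _ h2).congr fun τ => ?_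
    rw [fourierLift_apply, Finset.mul_sum]
    refine Finset.sum_congr rfl fun r _ => ?_
    rw [fourierMonomial_limitPath hl]
    have : Complex.exp ((2 * Real.pi * (growth T l hl k r - growth T l hl k q) * τ : ℝ) : ℂ) =
        Complex.exp ((2 * Real.pi * (-growth T l hl k q) * τ : ℝ) : ℂ) *
          Complex.exp ((2 * Real.pi * growth T l hl k r * τ : ℝ) : ℂ) := by
      rw [← Complex.exp_add]
      congr 1
      push_cast
      ring
    rw [this]
    ring
  have h3 : Tendsto (fun τ : ℝ => Complex.exp ((2 * Real.pi * (-growth T l hl k q) * τ : ℝ) : ℂ) *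
      fourierLift T l k a (limitPath T l k p τ)) atTop (𝓝 0) := by
    have h4 := tendsto_exp_two_pi_mul (neg_nonpos.mpr hN.le)
    rw [if_neg (neg_ne_zero.mpr hN.ne')] at h4
    have h4' := (isLittleO_one_iff ℝ).mpr h4
    have h5 := h4'.mul_isBigO (ha p)
    simp only [mul_one] at h5
    exact (isLittleO_one_iff ℝ).mp h5
  exact tendsto_nhds_unique h1 h3

/-! ### Invariance read off on exponents. -/

/-- The action of a simple reflection on exponents. -/
def reflectExponent (hl : T.minRank ≤ l) (i : Fin l) (m : (Fin l → ℤ) × ℤ) : (Fin l → ℤ) × ℤ :=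
  (m.1 + Matrix.vecMul (Pi.single i (-m.1 i)) (cartanInt hl), m.2)

lemma wt_reflectExponent (hl : T.minRank ≤ l) (i : Fin l) (m : (Fin l → ℤ) × ℤ) :
    wt T l (reflectExponent hl i m).1 = simpleReflection T l i (wt T l m.1) := by
  rw [reflectExponent, wt_add, ← rt_eq_wt, simpleReflection_wt hl]

lemma simpleReflection_simpleReflection (i : Fin l) (x : VC l) :
    simpleReflection T l i (simpleReflection T l i x) = x := by
  have h := congrArg (fun f : VC l ≃ₗ[ℂ] VC l => f x)
    (inv_eq_iff_mul_eq_one.mp (simpleReflection_inv (T := T) i))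
  exact h

lemma reflectExponent_reflectExponent (hl : T.minRank ≤ l) (i : Fin l) (m : (Fin l → ℤ) × ℤ) :
    reflectExponent hl i (reflectExponent hl i m) = m := by
  refine Prod.ext (wt_injective hl ?_) rfl
  rw [wt_reflectExponent, wt_reflectExponent, simpleReflection_simpleReflection]

/-- A simple reflection is a self-adjoint involution, so composing with it permutes the monomials
through their exponents; injectivity of `fourierLift` then compares coefficients. -/
lemma coeff_reflectExponent (hl : T.minRank ≤ l) (k i : Fin l)
    {a : AddMonoidAlgebra ℂ ((Fin l → ℤ) × ℤ)}
    (ha : ∀ x t, fourierLift T l k a (simpleReflection T l i x, t) = fourierLift T l k a (x, t))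
    (m : (Fin l → ℤ) × ℤ) : a.coeff (reflectExponent hl i m) = a.coeff m := by
  have hinj : Function.Injective (reflectExponent hl i) :=
    Function.LeftInverse.injective (reflectExponent_reflectExponent hl i)
  have h : AddMonoidAlgebra.ofCoeff (a.coeff.mapDomain (reflectExponent hl i)) = a := by
    apply fourierLift_injective hl k
    ext ⟨x, t⟩
    rw [← ha x t, fourierLift, AddMonoidAlgebra.lift_apply, AddMonoidAlgebra.lift_apply,
      AddMonoidAlgebra.coeff_ofCoeff, Finsupp.sum_mapDomain_index_inj hinj]
    simp only [Finsupp.sum, Finset.sum_apply, Pi.smul_apply]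
    refine Finset.sum_congr rfl fun r _ => ?_
    rw [fourierMonomial_apply hl, fourierMonomial_apply hl]
    simp only [wt_reflectExponent]
    rw [← simpleReflection_dot (T := T) i (simpleReflection T l i (wt T l r.1)),
      simpleReflection_simpleReflection]
    rfl
  conv_lhs => rw [← h]
  rw [AddMonoidAlgebra.coeff_ofCoeff, Finsupp.mapDomain_apply hinj]

/-- The shift multiplies each monomial by a constant phase, so invariance forces phase 1 on the
support. -/
lemma exists_int_of_shift_invariant (hl : T.minRank ≤ l) (k : Fin l)
    {a : AddMonoidAlgebra ℂ ((Fin l → ℤ) × ℤ)}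
    (ha : ∀ p, fourierLift T l k a (shiftMap T l k p) = fourierLift T l k a p)
    (m : (Fin l → ℤ) × ℤ) (hm : a.coeff m ≠ 0) :
    ∃ z : ℤ, (gam T l k : ℝ) * weightPair T l m.1 k - m.2 / (cartanInt hl).det = z := by
  have hd : ((cartanInt hl).det : ℂ) ≠ 0 := by exact_mod_cast cartanInt_det_ne_zero hl
  have hg : (gam T l k : ℂ) ≠ 0 := by exact_mod_cast (gam_pos T l k).ne'
  let ph : (Fin l → ℤ) × ℤ → ℂ := fun m => Complex.exp (2 * Real.pi * Complex.I *
    ((gam T l k : ℂ) * (weightPair T l m.1 k : ℂ) - (m.2 : ℂ) / ((cartanInt hl).det : ℂ)))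
  have h0 := eq_zero_of_sum_fourierMonomial hl k a.coeff.support
    (fun m => a.coeff m * (ph m - 1)) (fun p => ?_) m (Finsupp.mem_support_iff.mpr hm)
  · have h1 : ph m = 1 := by
      rw [mul_eq_zero, or_iff_right hm, sub_eq_zero] at h0
      exact h0
    obtain ⟨z, hz⟩ := exists_int_of_exp_two_pi_eq_one h1
    refine ⟨z, Complex.ofReal_injective ?_⟩
    generalize (cartanInt hl).det = D at hz ⊢
    push_cast
    exact hz
  · have h1 := sub_eq_zero.mpr (ha p)
    rw [fourierLift_apply, fourierLift_apply, ← Finset.sum_sub_distrib] at h1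
    rw [← h1]
    refine Finset.sum_congr rfl fun r _ => ?_
    have h2 : fourierMonomial T l k (Multiplicative.ofAdd r) (shiftMap T l k p) =
        ph r * fourierMonomial T l k (Multiplicative.ofAdd r) p := by
      rw [fourierMonomial_apply hl, fourierMonomial_apply hl, ← Complex.exp_add, shiftMap_apply]
      congr 1
      simp only [dotProduct_add, dotProduct_smul, wt_dot_fundWeight, smul_eq_mul]
      field_simp
      ring
    rw [h2]
    ring

/-! ### Orbit sums of fundamental weights. -/

instance weylGroup_fintype (T : BCD) (l : ℕ) : Fintype (weylGroup T l) := Fintype.ofFinite _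

/-- Coordinates of `w ω_j - ω_j` in the basis of simple roots. -/
def orbitRoot (hl : T.minRank ≤ l) (j : Fin l) (w : weylGroup T l) : Fin l → ℤ :=
  (exists_weylGroup_fundWeight hl w.2 j).choose

lemma orbitRoot_nonpos (hl : T.minRank ≤ l) (j : Fin l) (w : weylGroup T l) (i : Fin l) :
    orbitRoot hl j w i ≤ 0 :=
  (exists_weylGroup_fundWeight hl w.2 j).choose_spec.1 i

/-- Coordinates of `w ω_j` in the basis of fundamental weights. -/
def orbitWeight (hl : T.minRank ≤ l) (j : Fin l) (w : weylGroup T l) : Fin l → ℤ :=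
  Pi.single j 1 + Matrix.vecMul (orbitRoot hl j w) (cartanInt hl)

lemma wt_orbitWeight (hl : T.minRank ≤ l) (j : Fin l) (w : weylGroup T l) :
    wt T l (orbitWeight hl j w) = w.1 (fundWeight T l j) := by
  rw [orbitWeight, wt_add, wt_single, ← rt_eq_wt]
  exact (exists_weylGroup_fundWeight hl w.2 j).choose_spec.2.symm

lemma orbitWeight_one (hl : T.minRank ≤ l) (j : Fin l) :
    orbitWeight hl j 1 = Pi.single j 1 := by
  apply wt_injective hl
  rw [wt_orbitWeight, wt_single]
  rfl

lemma weightPair_orbitWeight (hl : T.minRank ≤ l) (j k : Fin l) (w : weylGroup T l) :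
    weightPair T l (orbitWeight hl j w) k =
      weightInner T l j k + orbitRoot hl j w k * halfNormSq T l k := by
  rw [orbitWeight, weightPair_add, weightPair_single, weightPair_vecMul]

lemma orbitRoot_mul_halfNormSq_nonpos (hl : T.minRank ≤ l) (j k : Fin l) (w : weylGroup T l) :
    (orbitRoot hl j w k : ℝ) * halfNormSq T l k ≤ 0 :=
  mul_nonpos_of_nonpos_of_nonneg (by exact_mod_cast orbitRoot_nonpos hl j w k)
    (halfNormSq_pos T l k).le

lemma orbitRoot_one (hl : T.minRank ≤ l) (j k : Fin l) : orbitRoot hl j 1 k = 0 := by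
  have h := weightPair_orbitWeight hl j k 1
  rw [orbitWeight_one, weightPair_single, left_eq_add, mul_eq_zero,
    or_iff_left (halfNormSq_pos T l k).ne'] at h
  exact_mod_cast h

/-- `y_j` as a sum over the orbit of `ω_j`. -/
lemma yFun_eq (j : Fin l) (x : VC l) :
    yFun T l j x = (1 / (nNum T l j : ℂ)) * ∑ w : weylGroup T l,
      Complex.exp (2 * Real.pi * Complex.I * (w.1 (fundWeight T l j) ⬝ᵥ x)) := by
  rw [yFun, finsum_eq_sum_of_fintype]
  congr 1
  -- Elements of W are orthogonal, so w ↦ w⁻¹ moves the action from the point to the weight.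
  refine Fintype.sum_equiv (Equiv.inv _) _ _ fun w => ?_
  rw [weylGroup_dot_inv w.2]
  rfl

lemma nNum_ne_zero (T : BCD) (l : ℕ) (j : Fin l) : nNum T l j ≠ 0 := by
  have : Nonempty {w : weylGroup T l // ∀ x : VC l,
    Complex.exp (2 * Real.pi * Complex.I * (fundWeight T l j ⬝ᵥ w.1 x)) =
      Complex.exp (2 * Real.pi * Complex.I * (fundWeight T l j ⬝ᵥ x))} := ⟨⟨1, fun x => rfl⟩⟩
  exact Nat.card_pos.ne'

lemma yFun_affine (hl : T.minRank ≤ l) (j : Fin l) {w : VC l ≃ₗ[ℂ] VC l}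
    (hw : w ∈ weylGroup T l) (m : Fin l → ℤ) (x : VC l) :
    yFun T l j (w x + ∑ i, (m i : ℂ) • simpleCoroot T l i) = yFun T l j x := by
  rw [yFun_eq, yFun_eq]
  congr 1
  refine Fintype.sum_equiv (Equiv.mulLeft (⟨w, hw⟩⁻¹ : weylGroup T l)) _ _ fun v => ?_
  have h1 : v.1 (fundWeight T l j) ⬝ᵥ w x = w⁻¹ (v.1 (fundWeight T l j)) ⬝ᵥ x :=
    weylGroup_dot_inv hw _ _
  have h2 : v.1 (fundWeight T l j) ⬝ᵥ ∑ i, (m i : ℂ) • simpleCoroot T l i =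
      ((∑ i, m i * orbitWeight hl j v i : ℤ) : ℂ) := by
    rw [← wt_orbitWeight hl, dotProduct_sum]
    simp [dotProduct_smul, wt_dot_simpleCoroot hl]
  rw [dotProduct_add, h1, mul_add, Complex.exp_add, exp_two_pi_mul_int _ h2, mul_one]
  rfl

/-- The phases cancel term by term: (wω_j, ω_k) − d_j is an integer times (α_k, α_k)/2, and γ makes
it an integer. -/
lemma exp_mul_yFun_shift (hl : T.minRank ≤ l) (j k : Fin l) (x : VC l) (t : ℂ) :
    Complex.exp (2 * Real.pi * Complex.I * dNum T l k j * (t - gam T l k)) *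
      yFun T l j (x + (gam T l k : ℂ) • fundWeight T l k) =
    Complex.exp (2 * Real.pi * Complex.I * dNum T l k j * t) * yFun T l j x := by
  rw [yFun_eq, yFun_eq, mul_left_comm, mul_left_comm _ (1 / (nNum T l j : ℂ))]
  congr 1
  rw [Finset.mul_sum, Finset.mul_sum]
  refine Finset.sum_congr rfl fun w _ => ?_
  obtain ⟨g, hg⟩ := exists_gam_mul_halfNormSq T l k
  have h1 : w.1 (fundWeight T l j) ⬝ᵥ fundWeight T l k =
      dNum T l k j + ((orbitRoot hl j w k : ℝ) : ℂ) * ((halfNormSq T l k : ℝ) : ℂ) := by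
    rw [← wt_orbitWeight hl, wt_dot_fundWeight, weightPair_orbitWeight, dNum_eq_ofReal]
    push_cast
    rfl
  have hg' : (gam T l k : ℂ) * ((halfNormSq T l k : ℝ) : ℂ) = g := by
    exact_mod_cast congrArg Complex.ofReal hg
  rw [dotProduct_add, dotProduct_smul, h1, ← Complex.exp_add, ← Complex.exp_add, smul_eq_mul]
  have h2 := exp_two_pi_mul_int (z := ((orbitRoot hl j w k : ℝ) : ℂ) * g)
    (orbitRoot hl j w k * g) (by push_cast; rfl)
  rw [← mul_one (Complex.exp (_ + 2 * Real.pi * Complex.I * (w.1 (fundWeight T l j) ⬝ᵥ x))), ← h2,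
    ← Complex.exp_add, ← hg']
  congr 1
  ring

/-- The formal counterpart of a partial sum of `y_j` over a subset `S` of the Weyl group, multiplied
by a power of the exponential in the last variable. -/
def orbitSum (hl : T.minRank ≤ l) (S : Finset (weylGroup T l)) (j : Fin l) (M : ℤ) :
    AddMonoidAlgebra ℂ ((Fin l → ℤ) × ℤ) :=
  (1 / (nNum T l j : ℂ)) • ∑ w ∈ S, AddMonoidAlgebra.single (orbitWeight hl j w, M) 1

lemma fourierLift_single (k : Fin l) (m : (Fin l → ℤ) × ℤ) :
    fourierLift T l k (AddMonoidAlgebra.single m 1) =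
      fourierMonomial T l k (Multiplicative.ofAdd m) := by
  simp [fourierLift, AddMonoidAlgebra.lift_single]

lemma fourierLift_orbitSum (hl : T.minRank ≤ l) (S : Finset (weylGroup T l)) (j k : Fin l) (M : ℤ)
    (p : VC l × ℂ) :
    fourierLift T l k (orbitSum hl S j M) p = (1 / (nNum T l j : ℂ)) * ∑ w ∈ S,
      Complex.exp (2 * Real.pi * Complex.I * (w.1 (fundWeight T l j) ⬝ᵥ p.1 +
        (M : ℂ) / ((gam T l k : ℂ) * ((cartanInt hl).det : ℂ)) * p.2)) := by
  rw [orbitSum, map_smul, map_sum]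
  simp only [fourierLift_single, Pi.smul_apply, Finset.sum_apply, fourierMonomial_apply hl,
    wt_orbitWeight, smul_eq_mul]

lemma coeff_orbitSum (hl : T.minRank ≤ l) (S : Finset (weylGroup T l)) (j : Fin l) (M : ℤ)
    (m : (Fin l → ℤ) × ℤ) :
    (orbitSum hl S j M).coeff m =
      (1 / (nNum T l j : ℂ)) * ((S.filter fun w => (orbitWeight hl j w, M) = m).card : ℂ) := by
  rw [orbitSum, AddMonoidAlgebra.coeff_smul_apply, AddMonoidAlgebra.coeff_sum,
    Finsupp.finsetSum_apply, smul_eq_mul]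
  simp [Finsupp.single_apply, Finset.sum_boole]

lemma exists_of_coeff_orbitSum_ne_zero (hl : T.minRank ≤ l) {S : Finset (weylGroup T l)}
    {j : Fin l} {M : ℤ} {m : (Fin l → ℤ) × ℤ} (h : (orbitSum hl S j M).coeff m ≠ 0) :
    ∃ w, (orbitWeight hl j w, M) = m := by
  rw [coeff_orbitSum] at h
  have h2 := right_ne_zero_of_mul h
  rw [Nat.cast_ne_zero, Finset.card_ne_zero] at h2
  obtain ⟨w, hw⟩ := h2
  exact ⟨w, (Finset.mem_filter.mp hw).2⟩

/-! ### Height, and leading exponents of the generators. -/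

/-- The integers `4 (ω_j, ω_k)`. -/
def weightInnerInt (T : BCD) (l : ℕ) (j k : Fin l) : ℤ :=
  (exists_int_four_mul_weightInner (T := T) j k).choose

lemma weightInnerInt_cast (j k : Fin l) :
    (weightInnerInt T l j k : ℝ) = 4 * weightInner T l j k :=
  (exists_int_four_mul_weightInner (T := T) j k).choose_spec.symm

/-- The height `4 ∑_k (λ, ω_k)` of a weight `λ`, as a function of the exponents. -/
def height (T : BCD) (l : ℕ) : (Fin l → ℤ) × ℤ →+ ℤ where
  toFun m := ∑ j, m.1 j * ∑ k, weightInnerInt T l j k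
  map_zero' := by simp
  map_add' m n := by simp [add_mul, Finset.sum_add_distrib]

lemma height_cast (m : (Fin l → ℤ) × ℤ) :
    (height T l m : ℝ) = 4 * ∑ k, weightPair T l m.1 k := by
  simp only [height, AddMonoidHom.coe_mk, ZeroHom.coe_mk, weightPair]
  push_cast
  simp only [weightInnerInt_cast, ← Finset.mul_sum]
  rw [Finset.sum_comm (s := Finset.univ) (t := Finset.univ), Finset.mul_sum]
  refine Finset.sum_congr rfl fun j _ => ?_
  rw [← Finset.mul_sum]
  ring

/-- Any other weight of the orbit has some strictly negative root coordinate, which lowers the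
height. The coefficient at ω_j is a nonzero multiple of the number of stabilizing elements in `S`. A
general `S` serves both y_j and its limit. -/
lemma isLead_orbitSum (hl : T.minRank ≤ l) {S : Finset (weylGroup T l)} (hS : 1 ∈ S) (j : Fin l)
    (M : ℤ) : AddMonoidAlgebra.IsLead (height T l) (orbitSum hl S j M) (Pi.single j 1, M) := by
  refine ⟨?_, fun m hm hne => ?_⟩
  · rw [coeff_orbitSum]
    refine mul_ne_zero (one_div_ne_zero (Nat.cast_ne_zero.mpr (nNum_ne_zero T l j))) ?_
    rw [Nat.cast_ne_zero, Finset.card_ne_zero]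
    exact ⟨1, Finset.mem_filter.mpr ⟨hS, by rw [orbitWeight_one]⟩⟩
  · obtain ⟨w, rfl⟩ := exists_of_coeff_orbitSum_ne_zero hl hm
    have h1 : ∃ i, orbitRoot hl j w i ≠ 0 := by
      by_contra! h
      apply hne
      rw [orbitWeight, show orbitRoot hl j w = 0 from funext h, Matrix.zero_vecMul, add_zero]
    obtain ⟨i, hi⟩ := h1
    rw [← Int.cast_lt (R := ℝ), height_cast, height_cast]
    refine mul_lt_mul_of_pos_left (Finset.sum_lt_sum (fun k _ => ?_) ⟨i, Finset.mem_univ _, ?_⟩)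
      (by norm_num)
    · simp only [weightPair_orbitWeight, weightPair_single]
      linarith [orbitRoot_mul_halfNormSq_nonpos hl j k w]
    · simp only [weightPair_orbitWeight, weightPair_single]
      have h2 : (orbitRoot hl j w i : ℝ) < 0 := by
        exact_mod_cast lt_of_le_of_ne (orbitRoot_nonpos hl j w i) hi
      linarith [mul_neg_of_neg_of_pos h2 (halfNormSq_pos T l i)]

lemma height_single_nonneg (hl : T.minRank ≤ l) (j : Fin l) (M : ℤ) :
    0 ≤ height T l (Pi.single j 1, M) := by
  rw [← Int.cast_le (R := ℝ), height_cast]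
  simp only [weightPair_single, Int.cast_zero]
  exact mul_nonneg (by norm_num) (Finset.sum_nonneg fun k _ => weightInner_nonneg hl j k)

lemma height_zero_fst (M : ℤ) : height T l (0, M) = 0 := by
  simp [height]

/-- The integer `γ f (ω_j, ω_k)`. -/
def degree (hl : T.minRank ≤ l) (k j : Fin l) : ℤ :=
  (exists_int_gam_mul_det_mul_weightInner hl j k).choose

lemma degree_cast (hl : T.minRank ≤ l) (k j : Fin l) :
    (degree hl k j : ℝ) = (gam T l k : ℝ) * (cartanInt hl).det * weightInner T l j k :=
  (exists_int_gam_mul_det_mul_weightInner hl j k).choose_spec.symm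

lemma gam_mul_det_real_ne_zero (hl : T.minRank ≤ l) (k : Fin l) :
    (gam T l k : ℝ) * ((cartanInt hl).det : ℝ) ≠ 0 := by
  refine mul_ne_zero ?_ ?_
  · exact_mod_cast (gam_pos T l k).ne'
  · exact_mod_cast cartanInt_det_ne_zero hl

lemma degree_div (hl : T.minRank ≤ l) (k j : Fin l) :
    (degree hl k j : ℝ) / ((gam T l k : ℝ) * (cartanInt hl).det) = weightInner T l j k := by
  rw [degree_cast, mul_div_cancel_left₀ _ (gam_mul_det_real_ne_zero hl k)]

lemma degree_div_complex (hl : T.minRank ≤ l) (k j : Fin l) :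
    (degree hl k j : ℂ) / ((gam T l k : ℂ) * ((cartanInt hl).det : ℂ)) = dNum T l k j := by
  rw [dNum_eq_ofReal, ← degree_div hl]
  generalize (cartanInt hl).det = D
  push_cast
  rfl

/-- The formal counterparts of the functions `yTilde`. -/
def generator (hl : T.minRank ≤ l) (k : Fin l) :
    Fin (l + 1) → AddMonoidAlgebra ℂ ((Fin l → ℤ) × ℤ) :=
  Fin.snoc (α := fun _ => AddMonoidAlgebra ℂ ((Fin l → ℤ) × ℤ))
    (fun j => orbitSum hl Finset.univ j (degree hl k j))
    (AddMonoidAlgebra.single (0, (cartanInt hl).det) 1)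

/-- The leading exponents of the generators. -/
def leadExponent (hl : T.minRank ≤ l) (k : Fin l) : Fin (l + 1) → (Fin l → ℤ) × ℤ :=
  Fin.snoc (α := fun _ => (Fin l → ℤ) × ℤ)
    (fun j => (Pi.single j 1, degree hl k j)) (0, (cartanInt hl).det)

lemma fourierLift_generator (hl : T.minRank ≤ l) (k : Fin l) (j : Fin (l + 1)) :
    fourierLift T l k (generator hl k j) = yTilde T l k j := by
  refine Fin.lastCases ?_ (fun j => ?_) j
  · simp only [generator, yTilde, Fin.snoc_last]
    rw [fourierLift_single]
    ext p
    rw [fourierMonomial_apply hl]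
    have h := gam_mul_det_ne_zero hl k
    congr 1
    simp only [wt, Pi.zero_apply, Int.cast_zero, zero_smul, Finset.sum_const_zero, zero_dotProduct,
      zero_add]
    have h1 : ((cartanInt hl).det : ℂ) ≠ 0 := right_ne_zero_of_mul h
    have h2 : (gam T l k : ℂ) ≠ 0 := left_ne_zero_of_mul h
    field_simp
  · simp only [generator, yTilde, Fin.snoc_castSucc]
    ext p
    rw [fourierLift_orbitSum, yFun_eq, mul_left_comm, Finset.mul_sum _ _ (Complex.exp _)]
    congr 1
    refine Finset.sum_congr rfl fun w _ => ?_
    rw [degree_div_complex, ← Complex.exp_add]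
    congr 1
    ring

lemma isLead_generator (hl : T.minRank ≤ l) (k : Fin l) (j : Fin (l + 1)) :
    AddMonoidAlgebra.IsLead (height T l) (generator hl k j) (leadExponent hl k j) := by
  refine Fin.lastCases ?_ (fun j => ?_) j
  · simp only [generator, leadExponent, Fin.snoc_last]
    exact AddMonoidAlgebra.isLead_single _ _ one_ne_zero
  · simp only [generator, leadExponent, Fin.snoc_castSucc]
    exact isLead_orbitSum hl (Finset.mem_univ _) j _

lemma height_leadExponent_nonneg (hl : T.minRank ≤ l) (k : Fin l) (j : Fin (l + 1)) :
    0 ≤ height T l (leadExponent hl k j) := by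
  refine Fin.lastCases ?_ (fun j => ?_) j
  · simp only [leadExponent, Fin.snoc_last, height_zero_fst, le_refl]
  · simp only [leadExponent, Fin.snoc_castSucc]
    exact height_single_nonneg hl j _

lemma sum_nsmul_single (s : Fin l → ℕ) (M : Fin l → ℤ) :
    ∑ j, s j • ((Pi.single j 1 : Fin l → ℤ), M j) =
      ((fun j => (s j : ℤ)), ∑ j, (s j : ℤ) * M j) := by
  ext i
  · simp [Prod.fst_sum, Finset.sum_apply, Pi.single_apply]
  · simp [Prod.snd_sum]

lemma sum_nsmul_leadExponent (hl : T.minRank ≤ l) (k : Fin l) (s : Fin (l + 1) → ℕ) :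
    ∑ j, s j • leadExponent hl k j = ((fun j : Fin l => (s j.castSucc : ℤ)),
      ∑ j : Fin l, (s j.castSucc : ℤ) * degree hl k j +
        (s (Fin.last l) : ℤ) * (cartanInt hl).det) := by
  rw [Fin.sum_univ_castSucc]
  simp only [leadExponent, Fin.snoc_last, Fin.snoc_castSucc]
  rw [sum_nsmul_single (fun j : Fin l => s j.castSucc)]
  simp

/-- The first `l` multiplicities are the weight coordinates; the last one is then determined because
f ≠ 0. -/
lemma injective_sum_leadExponent (hl : T.minRank ≤ l) (k : Fin l) :
    Function.Injective fun s : Fin (l + 1) →₀ ℕ => ∑ j, s j • leadExponent hl k j := by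
  intro s t h
  simp only [sum_nsmul_leadExponent, Prod.mk.injEq] at h
  obtain ⟨h1, h2⟩ := h
  have h3 : ∀ j : Fin l, s j.castSucc = t j.castSucc := fun j => by
    exact_mod_cast congrFun h1 j
  simp only [h3, add_right_inj] at h2
  ext j
  refine Fin.lastCases ?_ h3 j
  exact_mod_cast mul_right_cancel₀ (cartanInt_det_ne_zero hl) h2

/-! ### The ring of bounded invariants as a polynomial ring. -/

lemma yTilde_mem_ringA (hl : T.minRank ≤ l) (k : Fin l) (j : Fin (l + 1)) :
    yTilde T l k j ∈ ringA T l k := by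
  refine ⟨?_, fun g hg => ?_, fun p => ?_⟩
  · rw [← fourierLift_generator hl]
    exact AlgHom.mem_range_self _ _
  · unfold extWeylGroup at hg
    induction hg using Subgroup.closure_induction with
    | mem g hg =>
      rcases hg with ⟨w, hw, m, rfl⟩ | rfl
      · intro p
        rw [affineMap_apply]
        refine Fin.lastCases ?_ (fun j => ?_) j
        · simp only [yTilde, Fin.snoc_last]
        · simp only [yTilde, Fin.snoc_castSucc]
          rw [yFun_affine hl j hw]
      · intro p
        rw [shiftMap_apply]
        refine Fin.lastCases ?_ (fun j => ?_) j
        · simp only [yTilde, Fin.snoc_last]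
          have hg : (gam T l k : ℂ) ≠ 0 := by exact_mod_cast (gam_pos T l k).ne'
          rw [mul_sub, Complex.exp_sub, div_mul_cancel₀ _ hg, Complex.exp_two_pi_mul_I, div_one]
        · simp only [yTilde, Fin.snoc_castSucc]
          exact exp_mul_yFun_shift hl j k p.1 p.2
    | one => exact fun p => rfl
    | mul g g' _ _ h h' => exact fun p => (h _).trans (h' p)
    | inv g _ h => exact fun p => by rw [← h (g⁻¹ p)]; exact congrArg _ (g.apply_symm_apply p)
  · rw [← fourierLift_generator hl]
    refine isBigO_fourierLift hl k ?_ p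
    refine Fin.lastCases (fun m hm => ?_) (fun j m hm => ?_) j
    · simp only [generator, Fin.snoc_last] at hm
      have hm' : m = (0, (cartanInt hl).det) := by
        by_contra hne
        apply hm
        rw [AddMonoidAlgebra.coeff_single, Finsupp.single_apply, if_neg (Ne.symm hne)]
      have h1 : ((cartanInt hl).det : ℝ) ≠ 0 := right_ne_zero_of_mul (gam_mul_det_real_ne_zero hl k)
      have h2 : (0 : ℝ) < gam T l k := by exact_mod_cast gam_pos T l k
      rw [hm']
      simp only [growth, weightPair, Pi.zero_apply, Int.cast_zero, zero_mul, Finset.sum_const_zero,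
        zero_sub]
      -- The determinant cancels, leaving growth −1/γ whatever its sign.
      rw [div_mul_cancel_right₀ h1, neg_nonpos]
      positivity
    · simp only [generator, Fin.snoc_castSucc] at hm
      obtain ⟨w, rfl⟩ := exists_of_coeff_orbitSum_ne_zero hl hm
      -- The last exponent cancels d_j exactly, so only the nonpositive contribution of the k-th
      -- root coordinate remains.
      simp only [growth, weightPair_orbitWeight, degree_div]
      linarith [orbitRoot_mul_halfNormSq_nonpos hl j k w]

lemma simpleReflection_invariant {k : Fin l} {f : VC l × ℂ → ℂ} (hf : f ∈ ringA T l k) (i : Fin l)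
    (x : VC l) (t : ℂ) : f (simpleReflection T l i x, t) = f (x, t) := by
  have hmem : affineMap T l (simpleReflection T l i) 0 ∈ extWeylGroup T l k :=
    Subgroup.subset_closure (Or.inl ⟨_, Subgroup.subset_closure ⟨i, rfl⟩, 0, rfl⟩)
  have := hf.2.1 _ hmem (x, t)
  rw [affineMap_apply] at this
  simpa using this

lemma shiftMap_invariant {k : Fin l} {f : VC l × ℂ → ℂ} (hf : f ∈ ringA T l k) (p : VC l × ℂ) :
    f (shiftMap T l k p) = f p :=
  hf.2.1 _ (Subgroup.subset_closure (Or.inr rfl)) p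

/-- Exponents of maximal height of an element of `ringA` are dominant. -/
lemma fst_nonneg_of_height_max (hl : T.minRank ≤ l) (k : Fin l)
    {a : AddMonoidAlgebra ℂ ((Fin l → ℤ) × ℤ)} (ha : fourierLift T l k a ∈ ringA T l k)
    {q : (Fin l → ℤ) × ℤ} (hq : a.coeff q ≠ 0)
    (hmax : ∀ q', a.coeff q' ≠ 0 → height T l q' ≤ height T l q) (i : Fin l) : 0 ≤ q.1 i := by
  -- The reflected exponent is also in the support, and its height differs by −4 times `q.1 i` (α_i,
  -- α_i)/2; maximality forces `q.1 i ≥ 0`.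
  have h1 := hmax (reflectExponent hl i q) (by
    rw [coeff_reflectExponent hl k i (simpleReflection_invariant ha i)]; exact hq)
  rw [← Int.cast_le (R := ℝ), height_cast, height_cast] at h1
  simp only [reflectExponent, weightPair_add, weightPair_vecMul, Finset.sum_add_distrib] at h1
  have h0 : ∑ b, ((Pi.single i (-q.1 i) : Fin l → ℤ) b : ℝ) * halfNormSq T l b =
      -(q.1 i * halfNormSq T l i) := by
    rw [Finset.sum_eq_single i (fun b _ hb => by simp [hb]) (by simp)]
    simp
  rw [h0] at h1
  have h2 : (0 : ℝ) ≤ q.1 i * halfNormSq T l i := by linarith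
  have h3 : (0 : ℝ) ≤ q.1 i := nonneg_of_mul_nonneg_left h2 (halfNormSq_pos T l i)
  exact_mod_cast h3

/-- Exponents of maximal height of an element of `ringA` are leading exponents of monomials in the
generators. -/
lemma exists_eq_sum_leadExponent (hl : T.minRank ≤ l) (k : Fin l)
    {a : AddMonoidAlgebra ℂ ((Fin l → ℤ) × ℤ)} (ha : fourierLift T l k a ∈ ringA T l k)
    {q : (Fin l → ℤ) × ℤ} (hq : a.coeff q ≠ 0)
    (hmax : ∀ q', a.coeff q' ≠ 0 → height T l q' ≤ height T l q) :
    ∃ s : Fin (l + 1) →₀ ℕ, q = ∑ j, s j • leadExponent hl k j := by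
  have hpos := fst_nonneg_of_height_max hl k ha hq hmax
  obtain ⟨z, hz⟩ := exists_int_of_shift_invariant hl k (shiftMap_invariant ha) q hq
  have hgr := growth_nonpos_of_isBigO hl k ha.2.2 q hq
  have hD : ((cartanInt hl).det : ℝ) ≠ 0 := right_ne_zero_of_mul (gam_mul_det_real_ne_zero hl k)
  have hg : (0 : ℝ) < gam T l k := by exact_mod_cast gam_pos T l k
  -- The integer from shift invariance is γ times the growth; `-z` will be the exponent of ỹ_{l+1}.
  have hz0 : z ≤ 0 := by
    have h1 : (z : ℝ) = gam T l k * growth T l hl k q := by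
      rw [← hz, growth]
      field_simp
    have h2 : (z : ℝ) ≤ 0 := by
      rw [h1]
      exact mul_nonpos_of_nonneg_of_nonpos hg.le hgr
    exact_mod_cast h2
  have hsum : ((∑ j, q.1 j * degree hl k j : ℤ) : ℝ) =
      gam T l k * (cartanInt hl).det * weightPair T l q.1 k := by
    simp only [Int.cast_sum, Int.cast_mul, degree_cast, weightPair, Finset.mul_sum]
    exact Finset.sum_congr rfl fun j _ => by ring
  have hq2 : q.2 = ∑ j, q.1 j * degree hl k j + (-z) * (cartanInt hl).det := by
    have : (q.2 : ℝ) = ((∑ j, q.1 j * degree hl k j + (-z) * (cartanInt hl).det : ℤ) : ℝ) := by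
      rw [Int.cast_add, hsum, Int.cast_mul, Int.cast_neg, ← hz]
      field_simp
      ring
    exact_mod_cast this
  refine ⟨Finsupp.equivFunOnFinite.symm
    (Fin.snoc (α := fun _ => ℕ) (fun j => (q.1 j).toNat) (-z).toNat), ?_⟩
  rw [sum_nsmul_leadExponent]
  simp only [Finsupp.equivFunOnFinite_symm_apply_apply, Fin.snoc_castSucc, Fin.snoc_last,
    Int.toNat_of_nonneg (hpos _), Int.toNat_of_nonneg (neg_nonneg.mpr hz0)]
  exact Prod.ext rfl hq2

/-- The algebra isomorphism from the polynomial ring onto `ringA`. -/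
theorem exists_algEquiv_ringA (hl : T.minRank ≤ l) (k : Fin l) :
    ∃ e : MvPolynomial (Fin (l + 1)) ℂ ≃ₐ[ℂ] ringA T l k,
      ∀ j, (e (MvPolynomial.X j) : VC l × ℂ → ℂ) = yTilde T l k j := by
  let y : Fin (l + 1) → ringA T l k := fun j => ⟨yTilde T l k j, yTilde_mem_ringA hl k j⟩
  let F : MvPolynomial (Fin (l + 1)) ℂ →ₐ[ℂ] ringA T l k := MvPolynomial.aeval y
  -- Transfers bijectivity to the group algebra, where leading exponents are available.
  have hF : (ringA T l k).val.comp F =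
      (fourierLift T l k).comp (MvPolynomial.aeval (generator hl k)) := by
    apply MvPolynomial.algHom_ext
    intro j
    simp [F, y, fourierLift_generator hl]
  have hF' : ∀ P, (F P : VC l × ℂ → ℂ) =
      fourierLift T l k (MvPolynomial.aeval (generator hl k) P) :=
    fun P => DFunLike.congr_fun hF P
  have hinj : Function.Injective F := by
    intro P Q h
    have h1 := congrArg Subtype.val h
    rw [hF', hF'] at h1
    exact AddMonoidAlgebra.algebraicIndependent_of_isLead (isLead_generator hl k)
      (injective_sum_leadExponent hl k) (fourierLift_injective hl k h1)
  have hsurj : Function.Surjective F := by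
    rintro ⟨f, hf⟩
    obtain ⟨a, rfl⟩ := (AlgHom.mem_range _).mp hf.1
    obtain ⟨P, hP⟩ := (AlgHom.mem_range _).mp
      (AddMonoidAlgebra.mem_range_aeval_of_isLead (isLead_generator hl k)
        (height_leadExponent_nonneg hl k) ((ringA T l k).comap (fourierLift T l k))
        (fun j => by
          rw [Subalgebra.mem_comap, fourierLift_generator]
          exact yTilde_mem_ringA hl k j)
        (fun b hb q hq hmax => exists_eq_sum_leadExponent hl k hb hq hmax) (a := a) hf)
    exact ⟨P, Subtype.ext (by rw [hF', hP])⟩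
  refine ⟨AlgEquiv.ofBijective F ⟨hinj, hsurj⟩, fun j => ?_⟩
  change (F (MvPolynomial.X j) : VC l × ℂ → ℂ) = _
  simp [F, y]

/-! ### The limits and their algebraic independence. -/

/-- The limits `y_j^0`. -/
def yLimit (hl : T.minRank ≤ l) (k j : Fin l) (x : VC l) : ℂ :=
  fourierLift T l k (orbitSum hl (Finset.univ.filter fun w => orbitRoot hl j w k = 0) j 0) (x, 0)

/-- After normalization the term of w has rate proportional to the k-th root coordinate of wω_j −
ω_j: it is constant when that coordinate is 0 and decays otherwise. -/
lemma tendsto_yLimit (hl : T.minRank ≤ l) (k j : Fin l) (x : VC l) :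
    Tendsto (fun τ : ℝ => Complex.exp (-(2 * Real.pi * dNum T l k j * τ)) *
      yFun T l j (x - (Complex.I * τ) • fundWeight T l k)) atTop (𝓝 (yLimit hl k j x)) := by
  rw [yLimit, fourierLift_orbitSum, Finset.sum_filter]
  have h1 : ∀ w : weylGroup T l, Tendsto (fun τ : ℝ =>
      Complex.exp (2 * Real.pi * Complex.I * (w.1 (fundWeight T l j) ⬝ᵥ x)) *
        Complex.exp ((2 * Real.pi * (orbitRoot hl j w k * halfNormSq T l k) * τ : ℝ) : ℂ)) atTop
      (𝓝 (if orbitRoot hl j w k = 0 then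
        Complex.exp (2 * Real.pi * Complex.I * (w.1 (fundWeight T l j) ⬝ᵥ x + ((0 : ℤ) : ℂ) /
          ((gam T l k : ℂ) * ((cartanInt hl).det : ℂ)) * 0)) else 0)) := by
    intro w
    have := (tendsto_exp_two_pi_mul (orbitRoot_mul_halfNormSq_nonpos hl j k w)).const_mul
      (Complex.exp (2 * Real.pi * Complex.I * (w.1 (fundWeight T l j) ⬝ᵥ x)))
    convert this using 2
    by_cases h : orbitRoot hl j w k = 0
    · simp [h]
    · simp [h, (halfNormSq_pos T l k).ne']
  refine ((tendsto_finsetSum Finset.univ fun w _ => h1 w).const_mul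
    (1 / (nNum T l j : ℂ))).congr fun τ => ?_
  rw [yFun_eq, mul_left_comm]
  congr 1
  rw [Finset.mul_sum]
  refine Finset.sum_congr rfl fun w _ => ?_
  rw [← Complex.exp_add, ← Complex.exp_add]
  congr 1
  have h2 : w.1 (fundWeight T l j) ⬝ᵥ fundWeight T l k =
      dNum T l k j + ((orbitRoot hl j w k : ℝ) : ℂ) * ((halfNormSq T l k : ℝ) : ℂ) := by
    rw [← wt_orbitWeight hl, wt_dot_fundWeight, weightPair_orbitWeight, dNum_eq_ofReal]
    push_cast
    rfl
  rw [dotProduct_sub, dotProduct_smul, h2, smul_eq_mul]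
  push_cast
  linear_combination (2 * Real.pi * τ * (dNum T l k j +
    (orbitRoot hl j w k : ℂ) * ((halfNormSq T l k : ℝ) : ℂ))) * Complex.I_sq

lemma algebraicIndependent_yLimit (hl : T.minRank ≤ l) (k : Fin l) :
    AlgebraicIndependent ℂ (yLimit hl k) := by
  let Y : Fin l → AddMonoidAlgebra ℂ ((Fin l → ℤ) × ℤ) := fun j =>
    orbitSum hl (Finset.univ.filter fun w => orbitRoot hl j w k = 0) j 0
  have hY : AlgebraicIndependent ℂ Y := by
    refine AddMonoidAlgebra.algebraicIndependent_of_isLead (h := height T l)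
      (m := fun j => (Pi.single j 1, 0))
      (fun j => isLead_orbitSum hl
        (Finset.mem_filter.mpr ⟨Finset.mem_univ _, orbitRoot_one hl j k⟩) j 0) ?_
    intro s t h
    simp only [sum_nsmul_single _ fun _ => (0 : ℤ), Prod.mk.injEq] at h
    ext j
    exact_mod_cast congrFun h.1 j
  have hY' := hY.map' (f := fourierLift T l k) (fourierLift_injective hl k)
  -- Pullback along the projection to the first factor; the formal sums have last exponent 0, so
  -- they represent such pullbacks.
  let P : (VC l → ℂ) →ₐ[ℂ] (VC l × ℂ → ℂ) :=
    AlgHom.pi fun p => Pi.evalAlgHom ℂ (fun _ : VC l => ℂ) p.1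
  refine AlgebraicIndependent.of_comp P ?_
  convert hY' using 1
  ext j p
  simp only [Function.comp_apply, Y]
  change yLimit hl k j p.1 = _
  rw [yLimit, fourierLift_orbitSum, fourierLift_orbitSum]
  simp

end ExtAffine

end

theorem theorem1 (T : ExtAffine.BCD) (l : ℕ) (hl : T.minRank ≤ l) (k : Fin l) :
    (∃ e : MvPolynomial (Fin (l + 1)) ℂ ≃ₐ[ℂ] ExtAffine.ringA T l k,
      ∀ j, (e (MvPolynomial.X j) : ExtAffine.VC l × ℂ → ℂ) = ExtAffine.yTilde T l k j) ∧
    (∃ y₀ : Fin l → (ExtAffine.VC l → ℂ),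
      (∀ j x, Tendsto
        (fun τ : ℝ => Complex.exp (-(2 * Real.pi * ExtAffine.dNum T l k j * τ)) *
          ExtAffine.yFun T l j (x - (Complex.I * τ) • ExtAffine.fundWeight T l k))
        atTop (𝓝 (y₀ j x))) ∧
      AlgebraicIndependent ℂ y₀) :=
  ⟨ExtAffine.exists_algEquiv_ringA hl k, ExtAffine.yLimit hl k,
    ExtAffine.tendsto_yLimit hl k, ExtAffine.algebraicIndependent_yLimit hl k⟩
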